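/- Let $\Omega\subset\mathbb R^2$ be a bounded domain (open, connected) with $C^\infty$ boundary $\Gamma$, partitioned into three measurable parts $\Gamma_1,\Gamma_2,\Gamma_3$ of positive surface measure. Let $\xi>0$ and $g>0$ be constants, $f_0\in L^2(\Omega)$, $f_2\in L^2(\Gamma_2)$. Let $\gamma:H^1(\Omega)\to L^2(\Gamma)$ be the trace operator, and put $$X=\{v\in H^1(\Omega)\mid \gamma v=0\text{ a.e. on }\Gamma_1\},\qquad (u,v)_X=(\nabla u,\nabla v)_{L^2(\Omega)^2},\qquad a(u,v)=\xi\,(u,v)_X,$$ $$j(v)=\int_{\Gamma_3}g|\gamma v|\,d\Gamma,\qquad (f,v)_X=\int_\Omega f_0v\,dx+\int_{\Gamma_2}f_2\,\gamma v\,d\Gamma\qquad(u,v\in X).$$ Let $H^{1/2}(\Gamma)=\gamma(H^1(\Omega))$, with the norm $\|w\|=\inf\{\|v\|_{H^1(\Omega)}\mid \gamma v=w\}$, let $M=\gamma(X)\subseteq H^{1/2}(\Gamma)$ with the same norm, $Y=M'$, and let $X'$ be the dual of $X$. Put $$\Lambda=\{\mu\in Y\mid\langle\mu,\gamma v\rangle_{Y,M}\le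 j(v)\ \ \forall v\in X\},\qquad \bar\Lambda=\{\bar\mu\in X'\mid\langle\bar\mu,v\rangle_{X',X}\le j(v)\ \ \forall v\in X\},$$ and let $B^t:Y\to X'$ be given by $\langle B^t\mu,v\rangle_{X',X}=\langle\mu,\gamma v\rangle_{Y,M}$ for all $v\in X$. Consider the three problems: (1) find $u_0\in X$ with $a(u_0,v-u_0)+j(v)-j(u_0)\ge(f,v-u_0)_X$ for all $v\in X$; (2) find $(u,\lambda)\in X\times\Lambda$ with $a(u,v)+\langle\lambda,\gamma v\rangle_{Y,M}=(f,v)_X$ for all $v\in X$ and $\langle\mu-\lambda,\gamma u\rangle_{Y,M}\le0$ for all $\mu\in\Lambda$; (3) find $(\bar u,\bar\lambda)\in X\times\bar\Lambda$ with $a(\bar u,v)+\langle\bar\lambda,v\rangle_{X',X}=(f,v)_X$ for all $v\in X$ and $\langle\bar\mu-\bar\lambda,\bar u\rangle_{X',X}\le0$ for all $\bar\mu\in\bar\Lambda$. Then each of the problems (1), (2), (3) has exactly one solution. Let $u_0$, $(u,\lambda)$ and $(\bar u,\bar\lambda)$ be these solutions. There is exactly one $\widetilde\lambda\in Y$ with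 $B^t\widetilde\lambda=\bar\lambda$, and $$\bar u=u,\qquad \widetilde\lambda=\lambda .$$ Consequently all three formulations have the same primal solution: $u_0=u=\bar u$. -/

import Mathlib

open MeasureTheory Set Topology
open scoped ContDiff

noncomputable section

namespace Antiplane

/-- The Euclidean plane. -/
abbrev Plane : Type := EuclideanSpace ℝ (Fin 2)

/-- `∂Ω` is smooth: near every boundary point, in suitable Cartesian coordinates (`e` is a rigid
motion), `Ω` is the set of points lying strictly above the graph of a `C^∞` function `h`. -/
def HasSmoothBoundary (Ω : Set Plane) : Prop :=
  ∀ x ∈ frontier Ω, ∃ (U : Set Plane) (e : Plane ≃ᵃⁱ[ℝ] Plane) (h : ℝ → ℝ),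
    IsOpen U ∧ x ∈ U ∧ ContDiff ℝ ∞ h ∧ ∀ y ∈ U, (y ∈ Ω ↔ h (e y 0) < e y 1)

/-- The surface measure `dΓ` on `Γ = ∂Ω`, that is, arc length: the one-dimensional Hausdorff
measure restricted to `∂Ω`. -/
def bdryMeasure (Ω : Set Plane) : Measure Plane :=
  (Measure.hausdorffMeasure 1).restrict (frontier Ω)

/-- `L²(Ω)`. -/
abbrev L2 (Ω : Set Plane) : Type := Lp ℝ 2 (volume.restrict Ω)

/-- `L²(Ω)²`. -/
abbrev L2Vec (Ω : Set Plane) : Type := Lp Plane 2 (volume.restrict Ω)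

/-- `L²(Γ)`, where `Γ = ∂Ω`. -/
abbrev L2Bdry (Ω : Set Plane) : Type := Lp ℝ 2 (bdryMeasure Ω)

/-- Test functions, the elements of `C_c^∞(Ω)`. -/
def IsTestFunction (Ω : Set Plane) (φ : Plane → ℝ) : Prop :=
  ContDiff ℝ ∞ φ ∧ HasCompactSupport φ ∧ tsupport φ ⊆ Ω

/-- The classical partial derivative `∂ᵢ φ`. -/
def partialDeriv (i : Fin 2) (φ : Plane → ℝ) (x : Plane) : ℝ :=
  fderiv ℝ φ x (EuclideanSpace.single i 1)

/-- `G` is the weak gradient of `u` on `Ω`: `∫ u ∂ᵢφ dx = - ∫ Gᵢ φ dx` for all `φ ∈ C_c^∞(Ω)`. -/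
def IsWeakGradient (Ω : Set Plane) (u : L2 Ω) (G : L2Vec Ω) : Prop :=
  ∀ φ : Plane → ℝ, IsTestFunction Ω φ → ∀ i : Fin 2,
    ∫ x in Ω, u x * partialDeriv i φ x = - ∫ x in Ω, G x i * φ x

theorem IsTestFunction.memLp {Ω : Set Plane} {φ : Plane → ℝ} (h : IsTestFunction Ω φ) :
    MemLp φ 2 (volume.restrict Ω) :=
  (h.1.continuous.memLp_of_hasCompactSupport h.2.1).restrict Ω

theorem IsTestFunction.memLp_partialDeriv {Ω : Set Plane} {φ : Plane → ℝ}
    (h : IsTestFunction Ω φ) (i : Fin 2) :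
    MemLp (partialDeriv i φ) 2 (volume.restrict Ω) := by
  have hc : Continuous (partialDeriv i φ) :=
    (h.1.continuous_fderiv (by simp)).clm_apply continuous_const
  have hs : HasCompactSupport (partialDeriv i φ) := by
    refine (h.2.1.fderiv (𝕜 := ℝ)).mono ?_
    intro x hx hx'
    apply hx
    simp [partialDeriv, hx']
  exact (hc.memLp_of_hasCompactSupport hs).restrict Ω

theorem memLp_coord {Ω : Set Plane} (G : L2Vec Ω) (i : Fin 2) :
    MemLp (fun x => G x i) 2 (volume.restrict Ω) :=
  (Lp.memLp G).continuousLinearMap_comp (EuclideanSpace.proj i : Plane →L[ℝ] ℝ)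

theorem IsWeakGradient.zero (Ω : Set Plane) : IsWeakGradient Ω 0 0 := by
  intro φ _ i
  have h1 : ∫ x in Ω, (0 : L2 Ω) x * partialDeriv i φ x = 0 := by
    refine integral_eq_zero_of_ae ?_
    filter_upwards [Lp.coeFn_zero ℝ 2 (volume.restrict Ω)] with x hx
    simp only [hx, Pi.zero_apply, zero_mul]
  have h2 : ∫ x in Ω, (0 : L2Vec Ω) x i * φ x = 0 := by
    refine integral_eq_zero_of_ae ?_
    filter_upwards [Lp.coeFn_zero Plane 2 (volume.restrict Ω)] with x hx
    simp only [hx, Pi.zero_apply, PiLp.zero_apply, zero_mul]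
  rw [h1, h2, neg_zero]

theorem IsWeakGradient.add {Ω : Set Plane} {u v : L2 Ω} {G H : L2Vec Ω}
    (hu : IsWeakGradient Ω u G) (hv : IsWeakGradient Ω v H) :
    IsWeakGradient Ω (u + v) (G + H) := by
  intro φ hφ i
  have h1 : ∫ x in Ω, (u + v) x * partialDeriv i φ x =
      ∫ x in Ω, (u x * partialDeriv i φ x + v x * partialDeriv i φ x) := by
    refine integral_congr_ae ?_
    filter_upwards [Lp.coeFn_add u v] with x hx
    rw [hx, Pi.add_apply, add_mul]
  have h2 : ∫ x in Ω, (G + H) x i * φ x = ∫ x in Ω, (G x i * φ x + H x i * φ x) := by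
    refine integral_congr_ae ?_
    filter_upwards [Lp.coeFn_add G H] with x hx
    rw [hx, Pi.add_apply, PiLp.add_apply, add_mul]
  rw [h1, h2, integral_add, integral_add, hu φ hφ i, hv φ hφ i, neg_add]
  · exact (memLp_coord G i).integrable_mul hφ.memLp
  · exact (memLp_coord H i).integrable_mul hφ.memLp
  · exact (Lp.memLp u).integrable_mul (hφ.memLp_partialDeriv i)
  · exact (Lp.memLp v).integrable_mul (hφ.memLp_partialDeriv i)

theorem IsWeakGradient.smul {Ω : Set Plane} {u : L2 Ω} {G : L2Vec Ω} (c : ℝ)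
    (hu : IsWeakGradient Ω u G) : IsWeakGradient Ω (c • u) (c • G) := by
  intro φ hφ i
  have h1 : ∫ x in Ω, (c • u) x * partialDeriv i φ x =
      ∫ x in Ω, c * (u x * partialDeriv i φ x) := by
    refine integral_congr_ae ?_
    filter_upwards [Lp.coeFn_smul c u] with x hx
    simp [hx, mul_assoc]
  have h2 : ∫ x in Ω, (c • G) x i * φ x = ∫ x in Ω, c * (G x i * φ x) := by
    refine integral_congr_ae ?_
    filter_upwards [Lp.coeFn_smul c G] with x hx
    simp [hx, mul_assoc]
  rw [h1, h2, integral_const_mul, integral_const_mul, hu φ hφ i, mul_neg]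

/-- The pairs `(u, ∇u) ∈ L²(Ω) × L²(Ω)²`, `∇u` a weak gradient of `u`. -/
def subH1 (Ω : Set Plane) : Submodule ℝ (WithLp 2 (L2 Ω × L2Vec Ω)) where
  carrier := {p | IsWeakGradient Ω p.fst p.snd}
  zero_mem' := IsWeakGradient.zero Ω
  add_mem' := fun hp hq => IsWeakGradient.add hp hq
  smul_mem' := fun c _ hp => IsWeakGradient.smul c hp

/-- The Sobolev space `H¹(Ω)`. An element is the pair `(u, ∇u)` of a function `u ∈ L²(Ω)` and its
weak gradient `∇u ∈ L²(Ω)²` (which `u` determines when `Ω` is open); the norm is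
`‖u‖² = ‖u‖²_{L²} + ‖∇u‖²_{L²}`. -/
def H1 (Ω : Set Plane) : Type := subH1 Ω

instance (Ω : Set Plane) : NormedAddCommGroup (H1 Ω) :=
  inferInstanceAs (NormedAddCommGroup (subH1 Ω))

instance (Ω : Set Plane) : InnerProductSpace ℝ (H1 Ω) :=
  inferInstanceAs (InnerProductSpace ℝ (subH1 Ω))

/-- An element of `H¹(Ω)` as a pair `(u, ∇u)`. -/
def H1.toPair {Ω : Set Plane} : H1 Ω →ₗ[ℝ] WithLp 2 (L2 Ω × L2Vec Ω) := (subH1 Ω).subtype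

theorem H1.norm_def {Ω : Set Plane} (v : H1 Ω) : ‖v‖ = ‖H1.toPair v‖ := rfl

/-- The underlying function of `v ∈ H¹(Ω)`. -/
def H1.val {Ω : Set Plane} : H1 Ω →ₗ[ℝ] L2 Ω :=
  (WithLp.fstₗ 2 ℝ (L2 Ω) (L2Vec Ω)).comp H1.toPair

/-- The weak gradient of `v ∈ H¹(Ω)`. -/
def H1.grad {Ω : Set Plane} : H1 Ω →ₗ[ℝ] L2Vec Ω :=
  (WithLp.sndₗ 2 ℝ (L2 Ω) (L2Vec Ω)).comp H1.toPair

/-- The graph of the restriction `φ|Ω ↦ φ|Γ`, where `φ` ranges over the functions that are smooth up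
to the boundary (the restrictions of functions `φ ∈ C^∞(ℝ²)`), in `H¹(Ω) × L²(Γ)`. -/
def smoothGraph (Ω : Set Plane) : Submodule ℝ (H1 Ω × L2Bdry Ω) where
  carrier := {p | ∃ φ : Plane → ℝ, ContDiff ℝ ∞ φ ∧
    (H1.val p.1 : Plane → ℝ) =ᵐ[volume.restrict Ω] φ ∧
    (H1.grad p.1 : Plane → Plane) =ᵐ[volume.restrict Ω] gradient φ ∧
    (p.2 : Plane → ℝ) =ᵐ[bdryMeasure Ω] φ}
  zero_mem' := by
    refine ⟨fun _ => 0, contDiff_const, ?_, ?_, ?_⟩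
    · exact Lp.coeFn_zero ℝ 2 (volume.restrict Ω)
    · have h : gradient (fun _ : Plane => (0 : ℝ)) = 0 := by
        funext x
        exact gradient_fun_const x 0
      rw [h]
      exact Lp.coeFn_zero Plane 2 (volume.restrict Ω)
    · exact Lp.coeFn_zero ℝ 2 (bdryMeasure Ω)
  add_mem' := by
    rintro p q ⟨φ, hφ, h1, h2, h3⟩ ⟨ψ, hψ, k1, k2, k3⟩
    refine ⟨φ + ψ, hφ.add hψ, ?_, ?_, ?_⟩
    · rw [Prod.fst_add, map_add]
      exact (Lp.coeFn_add _ _).trans (h1.add k1)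
    · have h : gradient (φ + ψ) = gradient φ + gradient ψ := by
        funext x
        have hx := (hφ.differentiable (by simp)) x
        have kx := (hψ.differentiable (by simp)) x
        simp [gradient, fderiv_add hx kx]
      rw [Prod.fst_add, map_add, h]
      exact (Lp.coeFn_add _ _).trans (h2.add k2)
    · exact (Lp.coeFn_add _ _).trans (h3.add k3)
  smul_mem' := by
    rintro c p ⟨φ, hφ, h1, h2, h3⟩
    refine ⟨c • φ, hφ.const_smul c, ?_, ?_, ?_⟩
    · rw [Prod.smul_fst, map_smul]
      exact (Lp.coeFn_smul _ _).trans (h1.const_smul c)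
    · have h : gradient (c • φ) = c • gradient φ := by
        funext x
        have hx := (hφ.differentiable (by simp)) x
        simp [gradient, fderiv_const_smul hx c]
      rw [Prod.smul_fst, map_smul, h]
      exact (Lp.coeFn_smul _ _).trans (h2.const_smul c)
    · exact (Lp.coeFn_smul _ _).trans (h3.const_smul c)

/-- The domain of the trace operator: all `v ∈ H¹(Ω)` for which there are `φₙ ∈ C^∞(ℝ²)` such that
`φₙ → v` in `H¹(Ω)` and the restrictions of `φₙ` to `Γ` converge in `L²(Γ)`. For a bounded domain
with smooth boundary this is all of `H¹(Ω)`. -/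
def traceDomain (Ω : Set Plane) : Submodule ℝ (H1 Ω) :=
  (smoothGraph Ω).topologicalClosure.map (LinearMap.fst ℝ (H1 Ω) (L2Bdry Ω))

/-- The trace operator `γ : H¹(Ω) → L²(Γ)`: the operator obtained by closing the restriction
`φ|Ω ↦ φ|Γ` of functions smooth up to the boundary. So `γ v = w` means that there are
`φₙ ∈ C^∞(ℝ²)` with `φₙ → v` in `H¹(Ω)` and `φₙ → w` in `L²(Γ)`. For a bounded domain with smooth
boundary the restriction is continuous and densely defined, so that its closure is its unique
continuous extension, defined on all of `H¹(Ω)`. -/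
def trace (Ω : Set Plane) : traceDomain Ω →ₗ[ℝ] L2Bdry Ω :=
  (smoothGraph Ω).topologicalClosure.toLinearPMap.toFun

/-- The set `{v ∈ H¹(Ω) | γ v = 0 a.e. on Γ₁}` as a subspace of the domain of `γ`. -/
def subX (Ω Γ₁ : Set Plane) : Submodule ℝ (traceDomain Ω) where
  carrier := {v | ∀ᵐ x ∂((bdryMeasure Ω).restrict Γ₁), trace Ω v x = 0}
  zero_mem' := by
    have h := ae_restrict_of_ae (s := Γ₁) (Lp.coeFn_zero ℝ 2 (bdryMeasure Ω))
    filter_upwards [h] with x hx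
    rw [LinearMap.map_zero, hx]
    rfl
  add_mem' := by
    intro u v hu hv
    rw [mem_ofPred_eq] at hu hv ⊢
    have h := ae_restrict_of_ae (s := Γ₁) (Lp.coeFn_add (trace Ω u) (trace Ω v))
    filter_upwards [h, hu, hv] with x hx hxu hxv
    rw [LinearMap.map_add, hx, Pi.add_apply, hxu, hxv, add_zero]
  smul_mem' := by
    intro c u hu
    rw [mem_ofPred_eq] at hu ⊢
    have h := ae_restrict_of_ae (s := Γ₁) (Lp.coeFn_smul c (trace Ω u))
    filter_upwards [h, hu] with x hx hxu
    rw [LinearMap.map_smul, hx, Pi.smul_apply, hxu, smul_zero]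

/-- The space `X = {v ∈ H¹(Ω) | γ v = 0 a.e. on Γ₁}`, to be equipped with the inner product
`(u, v)_X = (∇u, ∇v)_{L²(Ω)²}`. -/
def X (Ω Γ₁ : Set Plane) : Type := subX Ω Γ₁

section X

variable (Ω Γ₁ : Set Plane)

instance : AddCommGroup (X Ω Γ₁) := inferInstanceAs (AddCommGroup (subX Ω Γ₁))

instance : Module ℝ (X Ω Γ₁) := inferInstanceAs (Module ℝ (subX Ω Γ₁))

variable {Ω Γ₁}

/-- The inclusion of `X` into the domain of the trace operator. -/
def X.toDomain : X Ω Γ₁ →ₗ[ℝ] (traceDomain Ω) := (subX Ω Γ₁).subtype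

/-- The inclusion `X ⊆ H¹(Ω)`. -/
def X.toH1 : X Ω Γ₁ →ₗ[ℝ] H1 Ω := (traceDomain Ω).subtype.comp X.toDomain

/-- The weak gradient of `v ∈ X`. -/
def X.grad : X Ω Γ₁ →ₗ[ℝ] L2Vec Ω := H1.grad.comp X.toH1

/-- `‖v‖_X = ‖∇v‖_{L²(Ω)²}`. -/
instance : SeminormedAddCommGroup (X Ω Γ₁) :=
  SeminormedAddCommGroup.induced (X Ω Γ₁) (L2Vec Ω) X.grad

/-- `(u, v)_X = (∇u, ∇v)_{L²(Ω)²}`. -/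
instance : InnerProductSpace ℝ (X Ω Γ₁) where
  toNormedSpace := NormedSpace.induced ℝ (X Ω Γ₁) (L2Vec Ω) X.grad
  inner u v := inner ℝ (X.grad u) (X.grad v)
  norm_sq_eq_re_inner u := norm_sq_eq_re_inner (𝕜 := ℝ) (X.grad u)
  conj_inner_symm u v := inner_conj_symm (𝕜 := ℝ) (X.grad u) (X.grad v)
  add_left u v w := by simp [inner_add_left]
  smul_left u v c := by simp [inner_smul_left]

/-- The trace `γ v ∈ L²(Γ)` of `v ∈ X`. -/
def X.trace (v : X Ω Γ₁) : L2Bdry Ω := Antiplane.trace Ω (X.toDomain v)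

end X

/-- The space `H^{1/2}(Γ) = {w ∈ L²(Γ) | w = γ v for some v ∈ H¹(Ω)}`, to be equipped with the
norm `‖w‖ = inf {‖v‖_{H¹(Ω)} | γ v = w}`. -/
def H12 (Ω : Set Plane) : Type := LinearMap.range (trace Ω)

section H12

variable (Ω : Set Plane)

instance : AddCommGroup (H12 Ω) := inferInstanceAs (AddCommGroup (LinearMap.range (trace Ω)))

instance : Module ℝ (H12 Ω) := inferInstanceAs (Module ℝ (LinearMap.range (trace Ω)))

/-- The inclusion `H^{1/2}(Γ) ⊆ L²(Γ)`. -/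
def H12.toL2 : H12 Ω →ₗ[ℝ] L2Bdry Ω := (LinearMap.range (trace Ω)).subtype

/-- The trace operator as a map onto `H^{1/2}(Γ)`. -/
def H12.ofTrace : (traceDomain Ω) →ₗ[ℝ] H12 Ω := (trace Ω).rangeRestrict

variable {Ω}

/-- The norm `‖w‖ = inf {‖v‖_{H¹(Ω)} | v ∈ H¹(Ω), γ v = w}` of `H^{1/2}(Γ)`. -/
def H12.qnorm (w : H12 Ω) : ℝ := sInf (norm '' {v : traceDomain Ω | H12.ofTrace Ω v = w})

theorem H12.qnorm_le {w : H12 Ω} {v : traceDomain Ω} (h : H12.ofTrace Ω v = w) :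
    H12.qnorm w ≤ ‖v‖ :=
  csInf_le ⟨0, by rintro _ ⟨v, _, rfl⟩; exact norm_nonneg v⟩ ⟨v, h, rfl⟩

theorem H12.exists_lt (w : H12 Ω) {ε : ℝ} (hε : 0 < ε) :
    ∃ v : traceDomain Ω, H12.ofTrace Ω v = w ∧ ‖v‖ < H12.qnorm w + ε := by
  obtain ⟨v₀, hv₀⟩ : ∃ v₀, H12.ofTrace Ω v₀ = w := LinearMap.surjective_rangeRestrict _ w
  have hne : (norm '' {v : traceDomain Ω | H12.ofTrace Ω v = w}).Nonempty := ⟨_, v₀, hv₀, rfl⟩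
  obtain ⟨_, ⟨v, hv, rfl⟩, hlt⟩ :=
    exists_lt_of_csInf_lt hne (lt_add_of_pos_right (H12.qnorm w) hε)
  exact ⟨v, hv, hlt⟩

theorem H12.qnorm_nonneg (w : H12 Ω) : 0 ≤ H12.qnorm w :=
  Real.sInf_nonneg (by rintro _ ⟨v, _, rfl⟩; exact norm_nonneg v)

theorem H12.qnorm_smul_le (c : ℝ) (w : H12 Ω) : H12.qnorm (c • w) ≤ ‖c‖ * H12.qnorm w := by
  refine le_of_forall_pos_le_add fun ε hε => ?_
  obtain ⟨v, hv, hlt⟩ := H12.exists_lt w (div_pos hε (by positivity : (0 : ℝ) < ‖c‖ + 1))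
  have h1 : H12.qnorm (c • w) ≤ ‖c • v‖ := H12.qnorm_le (by rw [map_smul, hv])
  have h2 : ‖c‖ * (ε / (‖c‖ + 1)) ≤ ε := by
    rw [← mul_div_assoc, div_le_iff₀ (by positivity)]
    nlinarith [norm_nonneg c]
  calc H12.qnorm (c • w) ≤ ‖c‖ * ‖v‖ := by rw [← norm_smul]; exact h1
    _ ≤ ‖c‖ * (H12.qnorm w + ε / (‖c‖ + 1)) := by gcongr
    _ = ‖c‖ * H12.qnorm w + ‖c‖ * (ε / (‖c‖ + 1)) := by ring
    _ ≤ ‖c‖ * H12.qnorm w + ε := by gcongr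

instance : SeminormedAddCommGroup (H12 Ω) :=
  AddGroupSeminorm.toSeminormedAddCommGroup
    { toFun := H12.qnorm
      map_zero' := le_antisymm
        ((H12.qnorm_le (map_zero (H12.ofTrace Ω))).trans norm_zero.le) (H12.qnorm_nonneg 0)
      add_le' := by
        intro w z
        refine le_of_forall_pos_le_add fun ε hε => ?_
        obtain ⟨u, hu, hu'⟩ := H12.exists_lt w (half_pos hε)
        obtain ⟨v, hv, hv'⟩ := H12.exists_lt z (half_pos hε)
        have h1 : H12.qnorm (w + z) ≤ ‖u + v‖ := H12.qnorm_le (by rw [map_add, hu, hv])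
        linarith [norm_add_le u v]
      neg' := by
        have h : ∀ w : H12 Ω, H12.qnorm (-w) ≤ H12.qnorm w := fun w => by
          simpa using H12.qnorm_smul_le (-1) w
        exact fun w => le_antisymm (h w) (by simpa using h (-w)) }

instance : NormedSpace ℝ (H12 Ω) where
  norm_smul_le := H12.qnorm_smul_le

theorem H12.norm_def (w : H12 Ω) :
    ‖w‖ = sInf (norm '' {v : traceDomain Ω | H12.ofTrace Ω v = w}) := rfl

end H12

section Formulations

variable {Ω Γ₁ : Set Plane}

/-- The trace operator as a map `X → H^{1/2}(Γ)`. -/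
def X.traceH12 : X Ω Γ₁ →ₗ[ℝ] H12 Ω := (H12.ofTrace Ω).comp X.toDomain

variable (Ω Γ₁) in
/-- `M = γ(X) ⊆ H^{1/2}(Γ)`, with the norm of `H^{1/2}(Γ)`. -/
def M : Submodule ℝ (H12 Ω) := LinearMap.range (X.traceH12 : X Ω Γ₁ →ₗ[ℝ] H12 Ω)

/-- The trace operator as a map `X → M`. -/
def X.traceM : X Ω Γ₁ →ₗ[ℝ] M Ω Γ₁ := X.traceH12.rangeRestrict

variable (Ω Γ₁) in
/-- `X'`, the dual of `X`. -/
abbrev XDual : Type := StrongDual ℝ (X Ω Γ₁)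

variable (Ω Γ₁) in
/-- `Y = M'`, the dual of `M = γ(X)`. -/
abbrev Y : Type := StrongDual ℝ (M Ω Γ₁)

/-- `a(u, v) = ξ (u, v)_X`. -/
def a (ξ : ℝ) (u v : X Ω Γ₁) : ℝ := ξ * inner ℝ u v

/-- `j(v) = ∫_{Γ₃} g |γ v| dΓ`. -/
def j (Γ₃ : Set Plane) (g : ℝ) (v : X Ω Γ₁) : ℝ :=
  ∫ x in Γ₃, g * |v.trace x| ∂(bdryMeasure Ω)

/-- The load functional `v ↦ (f, v)_X = ∫_Ω f₀ v dx + ∫_{Γ₂} f₂ γ v dΓ`. -/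
def load {Γ₂ : Set Plane} (f₀ : L2 Ω) (f₂ : Lp ℝ 2 ((bdryMeasure Ω).restrict Γ₂))
    (v : X Ω Γ₁) : ℝ :=
  (∫ x in Ω, f₀ x * H1.val v.toH1 x) + ∫ x in Γ₂, f₂ x * v.trace x ∂(bdryMeasure Ω)

/-- The bilinear form `b : X × Y → ℝ`, `b(v, μ) = ⟨μ, γ v⟩_{Y,M}`. -/
def b : X Ω Γ₁ →ₗ[ℝ] Y Ω Γ₁ →ₗ[ℝ] ℝ :=
  LinearMap.flip ((LinearMap.lcomp ℝ ℝ X.traceM).comp (ContinuousLinearMap.coeLM ℝ))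

/-- The operator `Bᵗ` on `Y`, `⟨Bᵗ μ, v⟩ = b(v, μ)` for all `v ∈ X`. Its values are viewed as
linear functionals on `X`; an equation `Bᵗ μ = l` with `l ∈ X'` is an equation of functionals. -/
def Bt : Y Ω Γ₁ →ₗ[ℝ] Module.Dual ℝ (X Ω Γ₁) := b.flip

/-- `Λ = {μ ∈ Y | ⟨μ, γ v⟩_{Y,M} ≤ ∫_{Γ₃} g |γ v| dΓ for all v ∈ X}`. -/
def Lam (Γ₃ : Set Plane) (g : ℝ) : Set (Y Ω Γ₁) :=
  {μ | ∀ v : X Ω Γ₁, μ v.traceM ≤ j Γ₃ g v}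

/-- `Λ̄ = {μ ∈ X' | ⟨μ, v⟩_{X',X} ≤ ∫_{Γ₃} g |γ v| dΓ for all v ∈ X}`. -/
def LamBar (Γ₃ : Set Plane) (g : ℝ) : Set (XDual Ω Γ₁) :=
  {μ | ∀ v : X Ω Γ₁, μ v ≤ j Γ₃ g v}

/-- `u₀ ∈ X` solves the variational inequality of the second kind
`a(u₀, v - u₀) + j(v) - j(u₀) ≥ (f, v - u₀)_X` for all `v ∈ X`. -/
def SolvesVI {Γ₂ : Set Plane} (Γ₃ : Set Plane) (ξ g : ℝ) (f₀ : L2 Ω)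
    (f₂ : Lp ℝ 2 ((bdryMeasure Ω).restrict Γ₂)) (u₀ : X Ω Γ₁) : Prop :=
  ∀ v : X Ω Γ₁, load f₀ f₂ (v - u₀) ≤ a ξ u₀ (v - u₀) + j Γ₃ g v - j Γ₃ g u₀

/-- `(u, λ) ∈ X × Λ` solves the mixed formulation with multipliers in `Λ ⊆ Y = (γ(X))'`. -/
def SolvesMixedTrace {Γ₂ : Set Plane} (Γ₃ : Set Plane) (ξ g : ℝ) (f₀ : L2 Ω)
    (f₂ : Lp ℝ 2 ((bdryMeasure Ω).restrict Γ₂)) (p : X Ω Γ₁ × Y Ω Γ₁) : Prop :=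
  p.2 ∈ Lam Γ₃ g ∧
  (∀ v : X Ω Γ₁, a ξ p.1 v + p.2 v.traceM = load f₀ f₂ v) ∧
  ∀ μ : Y Ω Γ₁, μ ∈ Lam Γ₃ g → (μ - p.2) p.1.traceM ≤ 0

/-- `(u, λ) ∈ X × Λ̄` solves the mixed formulation with multipliers in `Λ̄ ⊆ X'`. -/
def SolvesMixedDual {Γ₂ : Set Plane} (Γ₃ : Set Plane) (ξ g : ℝ) (f₀ : L2 Ω)
    (f₂ : Lp ℝ 2 ((bdryMeasure Ω).restrict Γ₂)) (p : X Ω Γ₁ × XDual Ω Γ₁) : Prop :=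
  p.2 ∈ LamBar Γ₃ g ∧
  (∀ v : X Ω Γ₁, a ξ p.1 v + p.2 v = load f₀ f₂ v) ∧
  ∀ μ : XDual Ω Γ₁, μ ∈ LamBar Γ₃ g → (μ - p.2) p.1 ≤ 0

end Formulations

end Antiplane

end

open Antiplane

/-!
All three formulations are solved by one pair. On a Hilbert space let `p` be a continuous seminorm
and `K` the closed convex set of functionals below `p`. Project the load `F` onto `K` (in the dual,
identified with the space) to get `l`, and put `ξ u = F - l`. The variational inequality of the
projection says that `l` maximizes `μ ↦ μ u` over `K`, which is the third formulation; by
Hahn–Banach the maximum is `p u`, so `l u = p u`, and this equality with `l ≤ p` gives the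
variational inequality of the second kind (`exists_multiplier`). Here `p = j`. A functional below
`j` vanishes on the kernel of the trace, since `j v` depends only on `γ v`, so it factors uniquely
through `γ : X → M`, with a continuous factor because `M` carries a quotient norm
(`exists_Y_of_mem_LamBar`); this carries the third formulation to the second. Uniqueness holds in
each formulation by the usual monotonicity argument.

This argument needs that `X` with the norm `‖∇v‖` is a Hilbert space on which `j` and the load are
continuous, hence the trace inequality (`exists_trace_inequality`) and the Friedrichs inequality
(`exists_friedrichs_inequality`). Since the trace is the closure of the restriction of smooth
functions, it is enough to prove both for functions smooth on the plane; density of these in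
`H¹(Ω)` plays no role. Both inequalities are proved without compact embeddings. Straightening the
boundary by measure-preserving graph charts reduces their local forms to rectangles, where they
follow from the fundamental theorem of calculus. The trace inequality globalizes by compactness of
`closure Ω`. The Poincaré–Wirtinger inequality passes from two overlapping open sets to their union,
so it holds on the connected set `Ω` by a chain of local domains
(`HasPoincareWirtinger.of_finset_cover`).
The Friedrichs inequality combines the two: the trace inequality on `Γ₁`, which has positive length,
controls the constant in the Poincaré–Wirtinger inequality.
-/

namespace Antiplane

open scoped ENNReal NNReal

/-! ### Inequalities on an interval and on a rectangle -/

theorem enorm_add_sq_le {E : Type*} [SeminormedAddCommGroup E] (x y : E) :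
    ‖x + y‖ₑ ^ 2 ≤ 2 * ‖x‖ₑ ^ 2 + 2 * ‖y‖ₑ ^ 2 := by
  have h : ‖x + y‖₊ ^ 2 ≤ 2 * ‖x‖₊ ^ 2 + 2 * ‖y‖₊ ^ 2 := by
    rw [← NNReal.coe_le_coe]
    push_cast
    have := norm_add_le x y
    nlinarith [norm_nonneg (x + y), norm_nonneg x, norm_nonneg y, sq_nonneg (‖x‖ - ‖y‖)]
  simp only [enorm_eq_nnnorm]
  exact_mod_cast h

theorem enorm_sub_sq_le {E : Type*} [SeminormedAddCommGroup E] (x y z : E) :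
    ‖x - z‖ₑ ^ 2 ≤ 2 * ‖x - y‖ₑ ^ 2 + 2 * ‖y - z‖ₑ ^ 2 := by
  simpa using enorm_add_sq_le (x - y) (y - z)

/-- The Cauchy–Schwarz inequality against the constant function `1`. -/
theorem lintegral_sq_le {α : Type*} [MeasurableSpace α] {μ : Measure α} {f : α → ℝ≥0∞}
    (hf : AEMeasurable f μ) : (∫⁻ x, f x ∂μ) ^ 2 ≤ μ univ * ∫⁻ x, f x ^ 2 ∂μ := by
  have h := ENNReal.lintegral_mul_le_Lp_mul_Lq μ Real.HolderConjugate.two_two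
    hf (aemeasurable_const (b := (1 : ℝ≥0∞)))
  simp only [Pi.mul_apply, mul_one, ENNReal.rpow_two, one_pow, lintegral_one] at h
  calc (∫⁻ x, f x ∂μ) ^ 2
      ≤ ((∫⁻ x, f x ^ 2 ∂μ) ^ (1 / 2 : ℝ) * μ univ ^ (1 / 2 : ℝ)) ^ 2 := by gcongr
    _ = μ univ * ∫⁻ x, f x ^ 2 ∂μ := by
        rw [mul_pow, ← ENNReal.rpow_two, ← ENNReal.rpow_two, ← ENNReal.rpow_mul,
          ← ENNReal.rpow_mul]
        norm_num [mul_comm]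

/-- A `C^1` function of one variable varies by at most `√ℓ ‖f'‖_{L²}` over an interval of length
`ℓ`. -/
theorem enorm_sub_sq_le_lintegral_deriv {f : ℝ → ℝ} (hf : ContDiff ℝ 1 f) {a b x y : ℝ}
    (hx : x ∈ Icc a b) (hy : y ∈ Icc a b) :
    ‖f x - f y‖ₑ ^ 2 ≤ ENNReal.ofReal (b - a) * ∫⁻ t in Ioo a b, ‖deriv f t‖ₑ ^ 2 := by
  wlog hxy : y ≤ x generalizing x y
  · rw [← enorm_neg, neg_sub]
    exact this hy hx (le_of_not_ge hxy)
  have hm : Measurable fun t => ‖deriv f t‖ₑ := (hf.continuous_deriv le_rfl).measurable.enorm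
  have h1 : ‖f x - f y‖ₑ ≤ ∫⁻ t in Icc a b, ‖deriv f t‖ₑ :=
    (enorm_sub_le_lintegral_deriv_of_contDiffOn_Icc hf.contDiffOn hxy).trans
      (lintegral_mono_set (Icc_subset_Icc hy.1 hx.2))
  rw [← restrict_Ioo_eq_restrict_Icc] at h1
  calc ‖f x - f y‖ₑ ^ 2 ≤ (∫⁻ t in Ioo a b, ‖deriv f t‖ₑ) ^ 2 := by gcongr
    _ ≤ _ := by simpa using lintegral_sq_le (μ := volume.restrict (Ioo a b)) hm.aemeasurable

theorem enorm_fst_sub_sq_le {ψ : ℝ × ℝ → ℝ} (hψ : ContDiff ℝ 1 ψ) {a b x y : ℝ}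
    (hx : x ∈ Icc a b) (hy : y ∈ Icc a b) (t : ℝ) :
    ‖ψ (x, t) - ψ (y, t)‖ₑ ^ 2 ≤
      ENNReal.ofReal (b - a) * ∫⁻ s in Ioo a b, ‖fderiv ℝ ψ (s, t)‖ₑ ^ 2 := by
  have hc : ContDiff ℝ 1 fun s => ψ (s, t) := hψ.comp (contDiff_id.prodMk contDiff_const)
  refine (enorm_sub_sq_le_lintegral_deriv hc hx hy).trans ?_
  gcongr with s
  have h : HasDerivAt (fun s => ψ (s, t)) (fderiv ℝ ψ (s, t) (1, 0)) s :=
    (hψ.differentiable one_ne_zero (s, t)).hasFDerivAt.comp_hasDerivAt s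
      ((hasDerivAt_id s).prodMk (hasDerivAt_const s t))
  rw [h.deriv]
  simpa [enorm_eq_nnnorm] using (ContinuousLinearMap.le_opENorm (fderiv ℝ ψ (s, t)) (1, 0))

theorem enorm_snd_sub_sq_le {ψ : ℝ × ℝ → ℝ} (hψ : ContDiff ℝ 1 ψ) {a b x y : ℝ}
    (hx : x ∈ Icc a b) (hy : y ∈ Icc a b) (s : ℝ) :
    ‖ψ (s, x) - ψ (s, y)‖ₑ ^ 2 ≤
      ENNReal.ofReal (b - a) * ∫⁻ t in Ioo a b, ‖fderiv ℝ ψ (s, t)‖ₑ ^ 2 := by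
  have hc : ContDiff ℝ 1 fun t => ψ (s, t) := hψ.comp (contDiff_const.prodMk contDiff_id)
  refine (enorm_sub_sq_le_lintegral_deriv hc hx hy).trans ?_
  gcongr with t
  have h : HasDerivAt (fun t => ψ (s, t)) (fderiv ℝ ψ (s, t) (0, 1)) t :=
    (hψ.differentiable one_ne_zero (s, t)).hasFDerivAt.comp_hasDerivAt t
      ((hasDerivAt_const t s).prodMk (hasDerivAt_id t))
  rw [h.deriv]
  simpa [enorm_eq_nnnorm] using (ContinuousLinearMap.le_opENorm (fderiv ℝ ψ (s, t)) (0, 1))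

theorem measurable_enorm_fderiv_sq {E : Type*} [NormedAddCommGroup E] [NormedSpace ℝ E]
    [MeasurableSpace E] [BorelSpace E] {φ : E → ℝ} (hφ : ContDiff ℝ 1 φ) :
    Measurable fun x => ‖fderiv ℝ φ x‖ₑ ^ 2 :=
  (hφ.continuous_fderiv one_ne_zero).enorm.measurable.pow_const 2

theorem setLIntegral_rect {f : ℝ × ℝ → ℝ≥0∞} (hf : Measurable f) (I J : Set ℝ) :
    ∫⁻ p in I ×ˢ J, f p = ∫⁻ s in I, ∫⁻ t in J, f (s, t) := by
  rw [Measure.volume_eq_prod, ← Measure.prod_restrict, lintegral_prod _ hf.aemeasurable]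

theorem setLIntegral_rect_symm {f : ℝ × ℝ → ℝ≥0∞} (hf : Measurable f) (I J : Set ℝ) :
    ∫⁻ p in I ×ˢ J, f p = ∫⁻ t in J, ∫⁻ s in I, f (s, t) := by
  rw [Measure.volume_eq_prod, ← Measure.prod_restrict, lintegral_prod_symm _ hf.aemeasurable]

/-- The Poincaré–Wirtinger inequality on an open rectangle. The constant is the value of `ψ` at a
point of a vertical segment on which the energy of `ψ` is at most its mean. -/
theorem exists_poincareWirtinger_rect {a b c d : ℝ} (hab : a < b) (hcd : c < d) :
    ∃ C : ℝ≥0, ∀ ψ : ℝ × ℝ → ℝ, ContDiff ℝ 1 ψ → ∃ m : ℝ,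
      ∫⁻ p in Ioo a b ×ˢ Ioo c d, ‖ψ p - m‖ₑ ^ 2 ≤
        C * ∫⁻ p in Ioo a b ×ˢ Ioo c d, ‖fderiv ℝ ψ p‖ₑ ^ 2 := by
  set A : ℝ≥0 := (b - a).toNNReal with hA
  set B : ℝ≥0 := (d - c).toNNReal with hB
  have hA0 : (A : ℝ≥0∞) ≠ 0 := by simpa [hA] using hab
  refine ⟨2 * A ^ 2 + 2 * B ^ 2, fun ψ hψ => ?_⟩
  set E : ℝ≥0∞ := ∫⁻ p in Ioo a b ×ˢ Ioo c d, ‖fderiv ℝ ψ p‖ₑ ^ 2 with hE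
  have hm := measurable_enorm_fderiv_sq hψ
  have hm2 : Measurable fun s => ∫⁻ t in Ioo c d, ‖fderiv ℝ ψ (s, t)‖ₑ ^ 2 :=
    hm.lintegral_prod_right'
  have hvA : volume (Ioo a b) = A := by simp [hA, ENNReal.ofReal]
  have hvB : volume (Ioo c d) = B := by simp [hB, ENNReal.ofReal]
  -- The segment `{s₀} × (c, d)` carries at most the mean energy.
  obtain ⟨s₀, hs₀, hle⟩ := exists_le_setLAverage (μ := volume) (s := Ioo a b)
    (by rwa [hvA]) (by simp) hm2.aemeasurable
  rw [setLAverage_eq, hvA, ← setLIntegral_rect hm, ← hE] at hle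
  have hmul : A * ∫⁻ t in Ioo c d, ‖fderiv ℝ ψ (s₀, t)‖ₑ ^ 2 ≤ E := by
    calc _ ≤ A * (E / A) := by gcongr
      _ = E := ENNReal.mul_div_cancel hA0 (by simp)
  have ht₀ : (c + d) / 2 ∈ Ioo c d := ⟨by linarith, by linarith⟩
  set m := ψ (s₀, (c + d) / 2)
  refine ⟨m, ?_⟩
  have hmeas : Measurable fun p => ‖ψ p - m‖ₑ ^ 2 :=
    (hψ.continuous.sub continuous_const).enorm.measurable.pow_const 2
  have hpt : ∀ t ∈ Ioo c d, ∀ s ∈ Ioo a b, ‖ψ (s, t) - m‖ₑ ^ 2 ≤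
      2 * (A * ∫⁻ s in Ioo a b, ‖fderiv ℝ ψ (s, t)‖ₑ ^ 2) +
      2 * (B * ∫⁻ t in Ioo c d, ‖fderiv ℝ ψ (s₀, t)‖ₑ ^ 2) := by
    intro t ht s hs
    refine (enorm_sub_sq_le _ (ψ (s₀, t)) _).trans ?_
    gcongr
    · exact enorm_fst_sub_sq_le hψ (Ioo_subset_Icc_self hs) (Ioo_subset_Icc_self hs₀) t
    · exact enorm_snd_sub_sq_le hψ (Ioo_subset_Icc_self ht) (Ioo_subset_Icc_self ht₀) s₀
  calc ∫⁻ p in Ioo a b ×ˢ Ioo c d, ‖ψ p - m‖ₑ ^ 2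
      = ∫⁻ t in Ioo c d, ∫⁻ s in Ioo a b, ‖ψ (s, t) - m‖ₑ ^ 2 :=
        setLIntegral_rect_symm hmeas _ _
    _ ≤ ∫⁻ t in Ioo c d, ∫⁻ _ in Ioo a b,
          (2 * (A * ∫⁻ s in Ioo a b, ‖fderiv ℝ ψ (s, t)‖ₑ ^ 2) +
          2 * (B * ∫⁻ t in Ioo c d, ‖fderiv ℝ ψ (s₀, t)‖ₑ ^ 2)) :=
        setLIntegral_mono' measurableSet_Ioo fun t ht =>
          setLIntegral_mono' measurableSet_Ioo (hpt t ht)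
    _ = 2 * A ^ 2 * E + 2 * B ^ 2 * (A * ∫⁻ t in Ioo c d, ‖fderiv ℝ ψ (s₀, t)‖ₑ ^ 2) := by
        simp only [setLIntegral_const, hvA]
        rw [lintegral_mul_const' _ _ (by simp), lintegral_add_right _ measurable_const,
          lintegral_const_mul' _ _ (by simp), lintegral_const_mul' _ _ (by simp),
          ← setLIntegral_rect_symm hm, setLIntegral_const, hvB, ← hE]
        ring
    _ ≤ 2 * A ^ 2 * E + 2 * B ^ 2 * E := by gcongr
    _ = _ := by push_cast; ring

/-- The trace inequality for the lower side of a rectangle. -/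
theorem exists_trace_rect (a b : ℝ) {η : ℝ} (hη : 0 < η) :
    ∃ C : ℝ≥0, ∀ ψ : ℝ × ℝ → ℝ, ContDiff ℝ 1 ψ →
      ∫⁻ s in Ioo a b, ‖ψ (s, 0)‖ₑ ^ 2 ≤
        C * ((∫⁻ p in Ioo a b ×ˢ Ioo 0 η, ‖ψ p‖ₑ ^ 2) +
          ∫⁻ p in Ioo a b ×ˢ Ioo 0 η, ‖fderiv ℝ ψ p‖ₑ ^ 2) := by
  set B : ℝ≥0 := η.toNNReal with hB
  have hB0 : B ≠ 0 := by simpa [hB] using hη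
  have hB0' : (B : ℝ≥0∞) ≠ 0 := by simpa using hB0
  have hvB : volume (Ioo 0 η) = B := by simp [hB, ENNReal.ofReal]
  refine ⟨2 * B⁻¹ + 2 * B, fun ψ hψ => ?_⟩
  have hm := measurable_enorm_fderiv_sq hψ
  have hm' : Measurable fun p => ‖ψ p‖ₑ ^ 2 := hψ.continuous.enorm.measurable.pow_const 2
  have hpt : ∀ s, B * ‖ψ (s, 0)‖ₑ ^ 2 ≤ 2 * (∫⁻ t in Ioo 0 η, ‖ψ (s, t)‖ₑ ^ 2) +
      2 * B ^ 2 * ∫⁻ t in Ioo 0 η, ‖fderiv ℝ ψ (s, t)‖ₑ ^ 2 := by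
    intro s
    calc B * ‖ψ (s, 0)‖ₑ ^ 2 = ∫⁻ t in Ioo 0 η, ‖ψ (s, 0)‖ₑ ^ 2 := by
          rw [setLIntegral_const, hvB, mul_comm]
      _ ≤ ∫⁻ t in Ioo 0 η, (2 * ‖ψ (s, t)‖ₑ ^ 2 +
            2 * (B * ∫⁻ t in Ioo 0 η, ‖fderiv ℝ ψ (s, t)‖ₑ ^ 2)) := by
          refine setLIntegral_mono' measurableSet_Ioo fun t ht => ?_
          have h := enorm_add_sq_le (ψ (s, t)) (ψ (s, 0) - ψ (s, t))
          rw [add_sub_cancel] at h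
          refine h.trans ?_
          gcongr
          simpa [hB, ENNReal.ofReal] using enorm_snd_sub_sq_le hψ (a := 0) (b := η) (x := 0)
            (y := t) ⟨le_rfl, hη.le⟩ (Ioo_subset_Icc_self ht) s
      _ = _ := by
          rw [lintegral_add_right _ measurable_const, lintegral_const_mul' _ _ (by simp),
            setLIntegral_const, hvB]
          ring
  have hint : B * ∫⁻ s in Ioo a b, ‖ψ (s, 0)‖ₑ ^ 2 ≤
      2 * (∫⁻ p in Ioo a b ×ˢ Ioo 0 η, ‖ψ p‖ₑ ^ 2) +
        2 * B ^ 2 * ∫⁻ p in Ioo a b ×ˢ Ioo 0 η, ‖fderiv ℝ ψ p‖ₑ ^ 2 := by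
    rw [← lintegral_const_mul' _ _ (by simp)]
    refine (lintegral_mono hpt).trans_eq ?_
    rw [lintegral_add_left (hm'.lintegral_prod_right'.const_mul 2),
      lintegral_const_mul' _ _ (by simp),
      lintegral_const_mul' _ _ (ENNReal.mul_ne_top (by simp) (by simp)),
      ← setLIntegral_rect hm', ← setLIntegral_rect hm]
  set V := ∫⁻ p in Ioo a b ×ˢ Ioo 0 η, ‖ψ p‖ₑ ^ 2
  set E := ∫⁻ p in Ioo a b ×ˢ Ioo 0 η, ‖fderiv ℝ ψ p‖ₑ ^ 2
  set T := ∫⁻ s in Ioo a b, ‖ψ (s, 0)‖ₑ ^ 2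
  have hinv : ((B⁻¹ : ℝ≥0) : ℝ≥0∞) * B = 1 := by
    rw [← ENNReal.coe_mul, inv_mul_cancel₀ hB0, ENNReal.coe_one]
  calc T = ((B⁻¹ : ℝ≥0) : ℝ≥0∞) * (B * T) := by rw [← mul_assoc, hinv, one_mul]
    _ ≤ ((B⁻¹ : ℝ≥0) : ℝ≥0∞) * (2 * V + 2 * B ^ 2 * E) := by gcongr
    _ = 2 * ((B⁻¹ : ℝ≥0) : ℝ≥0∞) * V + 2 * (((B⁻¹ : ℝ≥0) : ℝ≥0∞) * B) * B * E := by ring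
    _ ≤ (2 * ((B⁻¹ : ℝ≥0) : ℝ≥0∞) + 2 * B) * V + (2 * ((B⁻¹ : ℝ≥0) : ℝ≥0∞) + 2 * B) * E := by
        rw [hinv, mul_one]
        gcongr
        · exact le_self_add
        · exact le_add_self
    _ = _ := by push_cast; ring

/-! ### Straightening the boundary -/

/-- The coordinates straightening the graph of `h` in the Cartesian coordinates given by `e`: the
point with parameters `(s, τ)` has Cartesian coordinates `(s, h s + τ)`. -/
noncomputable def graphChart (e : Plane ≃ᵃⁱ[ℝ] Plane) {h : ℝ → ℝ} (hh : Continuous h) :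
    ℝ × ℝ ≃ₜ Plane where
  toFun p := e.symm !₂[p.1, h p.1 + p.2]
  invFun y := (e y 0, e y 1 - h (e y 0))
  left_inv p := by simp
  right_inv y := by
    rw [AffineIsometryEquiv.symm_apply_eq]
    ext i
    fin_cases i <;> simp
  continuous_toFun := by
    have h1 : Continuous fun p : ℝ × ℝ => (!₂[p.1, h p.1 + p.2] : Plane) := by fun_prop
    exact e.symm.continuous.comp h1
  continuous_invFun := by
    have h0 (i : Fin 2) : Continuous fun y => e y i :=
      (EuclideanSpace.proj i : Plane →L[ℝ] ℝ).continuous.comp e.continuous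
    exact (h0 0).prodMk ((h0 1).sub (hh.comp (h0 0)))

theorem contDiff_graphChart (e : Plane ≃ᵃⁱ[ℝ] Plane) {h : ℝ → ℝ} (hh : ContDiff ℝ 1 h) :
    ContDiff ℝ 1 (graphChart e hh.continuous) := by
  have h1 : ContDiff ℝ 1 fun p : ℝ × ℝ => (!₂[p.1, h p.1 + p.2] : Plane) := by
    rw [contDiff_euclidean]
    intro i
    fin_cases i
    · exact contDiff_fst
    · exact (hh.comp contDiff_fst).add contDiff_snd
  exact (e.symm.toAffineIsometry.toContinuousAffineMap.contDiff).comp h1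

theorem measurePreserving_affineIsometryEquiv (e : Plane ≃ᵃⁱ[ℝ] Plane) :
    MeasurePreserving e := by
  have h : (e : Plane → Plane) = fun x => e.linearIsometryEquiv x + e 0 := by
    funext x
    simpa using e.map_vadd 0 x
  rw [h]
  exact (measurePreserving_add_right volume (e 0)).comp e.linearIsometryEquiv.measurePreserving

theorem measurePreserving_graphChart (e : Plane ≃ᵃⁱ[ℝ] Plane) {h : ℝ → ℝ} (hh : Continuous h) :
    MeasurePreserving (graphChart e hh) := by
  have h1 : MeasurePreserving (fun p : ℝ × ℝ => (p.1, h p.1 + p.2)) :=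
    (MeasurePreserving.id volume).skew_product (g := fun s t => h s + t)
      (by fun_prop) (.of_forall fun s => (measurePreserving_add_left volume (h s)).map_eq)
  have h2 : MeasurePreserving fun p : ℝ × ℝ => (!₂[p.1, p.2] : Plane) :=
    (PiLp.volume_preserving_toLp (Fin 2)).comp (volume_preserving_finTwoArrow ℝ).symm
  exact (measurePreserving_affineIsometryEquiv e.symm).comp (h2.comp h1)

theorem setLIntegral_image_graphChart (e : Plane ≃ᵃⁱ[ℝ] Plane) {h : ℝ → ℝ} (hh : Continuous h)
    (f : Plane → ℝ≥0∞) (Q : Set (ℝ × ℝ)) :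
    ∫⁻ x in graphChart e hh '' Q, f x = ∫⁻ p in Q, f (graphChart e hh p) :=
  ((measurePreserving_graphChart e hh).setLIntegral_comp_emb
    (graphChart e hh).measurableEmbedding f Q).symm

theorem enorm_comp_le {E F G : Type*} [NormedAddCommGroup E] [NormedSpace ℝ E]
    [NormedAddCommGroup F] [NormedSpace ℝ F] [NormedAddCommGroup G] [NormedSpace ℝ G]
    (f : F →L[ℝ] G) (g : E →L[ℝ] F) : ‖f.comp g‖ₑ ≤ ‖f‖ₑ * ‖g‖ₑ := by
  simp only [enorm_eq_nnnorm]
  exact_mod_cast f.opNNNorm_comp_le g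

/-- The energy of a function in straightened coordinates is controlled by its energy. -/
theorem exists_lintegral_fderiv_comp_le (e : Plane ≃ᵃⁱ[ℝ] Plane) {h : ℝ → ℝ}
    (hh : ContDiff ℝ 1 h) (a b c d : ℝ) :
    ∃ K : ℝ≥0, ∀ φ : Plane → ℝ, ContDiff ℝ 1 φ →
      ∫⁻ p in Ioo a b ×ˢ Ioo c d, ‖fderiv ℝ (φ ∘ graphChart e hh.continuous) p‖ₑ ^ 2 ≤
        K * ∫⁻ x in graphChart e hh.continuous '' (Ioo a b ×ˢ Ioo c d), ‖fderiv ℝ φ x‖ₑ ^ 2 := by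
  set Φ := graphChart e hh.continuous
  have hΦ : ContDiff ℝ 1 Φ := contDiff_graphChart e hh
  obtain ⟨K, hK⟩ := ((isCompact_Icc (a := a) (b := b)).prod
    (isCompact_Icc (a := c) (b := d))).exists_bound_of_continuousOn
      (hΦ.continuous_fderiv one_ne_zero).continuousOn
  refine ⟨K.toNNReal ^ 2, fun φ hφ => ?_⟩
  rw [setLIntegral_image_graphChart, ← lintegral_const_mul' _ _ (by simp)]
  refine setLIntegral_mono' (measurableSet_Ioo.prod measurableSet_Ioo) fun p hp => ?_
  have hp' : ‖fderiv ℝ Φ p‖ₑ ≤ K.toNNReal := by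
    rw [enorm_eq_nnnorm, ENNReal.coe_le_coe, ← NNReal.coe_le_coe, coe_nnnorm]
    exact (hK p (prod_mono Ioo_subset_Icc_self Ioo_subset_Icc_self hp)).trans
      (Real.le_coe_toNNReal K)
  rw [fderiv_comp p (hφ.differentiable one_ne_zero _) (hΦ.differentiable one_ne_zero p)]
  calc _ ≤ (‖fderiv ℝ φ (Φ p)‖ₑ * ‖fderiv ℝ Φ p‖ₑ) ^ 2 := by
        gcongr
        exact enorm_comp_le _ _
    _ ≤ (‖fderiv ℝ φ (Φ p)‖ₑ * K.toNNReal) ^ 2 := by gcongr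
    _ = _ := by push_cast; ring

/-- The Poincaré–Wirtinger inequality on `A`, for functions of class `C^1` on the plane: such a
function differs in `L²(A)` from some constant by at most a multiple of `‖∇φ‖_{L²(A)}`. -/
def HasPoincareWirtinger (A : Set Plane) : Prop :=
  ∃ C : ℝ≥0, ∀ φ : Plane → ℝ, ContDiff ℝ 1 φ → ∃ m : ℝ,
    ∫⁻ x in A, ‖φ x - m‖ₑ ^ 2 ≤ C * ∫⁻ x in A, ‖fderiv ℝ φ x‖ₑ ^ 2

theorem hasPoincareWirtinger_image_graphChart (e : Plane ≃ᵃⁱ[ℝ] Plane) {h : ℝ → ℝ}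
    (hh : ContDiff ℝ 1 h) {a b c d : ℝ} (hab : a < b) (hcd : c < d) :
    HasPoincareWirtinger (graphChart e hh.continuous '' (Ioo a b ×ˢ Ioo c d)) := by
  obtain ⟨C, hC⟩ := exists_poincareWirtinger_rect hab hcd
  obtain ⟨K, hK⟩ := exists_lintegral_fderiv_comp_le e hh a b c d
  refine ⟨C * K, fun φ hφ => ?_⟩
  obtain ⟨m, hm⟩ := hC _ (hφ.comp (contDiff_graphChart e hh))
  refine ⟨m, ?_⟩
  rw [setLIntegral_image_graphChart e hh.continuous (fun x => ‖φ x - m‖ₑ ^ 2)]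
  refine hm.trans ?_
  rw [ENNReal.coe_mul, mul_assoc]
  gcongr
  exact hK φ hφ

/-- Arc length on a Lipschitz curve is controlled by Lebesgue measure on the parameter interval. -/
theorem lintegral_hausdorffMeasure_le {γ : ℝ → Plane} {I : Set ℝ} {K : ℝ≥0}
    (hγ : LipschitzOnWith K γ I) (hγm : Measurable γ) {S : Set Plane} (hS : S ⊆ γ '' I)
    {f : Plane → ℝ≥0∞} (hf : Measurable f) :
    ∫⁻ x in S, f x ∂(Measure.hausdorffMeasure 1) ≤ K * ∫⁻ s in I, f (γ s) := by
  have h : (Measure.hausdorffMeasure 1 : Measure Plane).restrict S ≤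
      (K : ℝ≥0∞) • (volume.restrict I).map γ := by
    refine Measure.le_iff.2 fun A hA => ?_
    rw [Measure.restrict_apply hA, Measure.smul_apply, Measure.map_apply hγm hA,
      Measure.restrict_apply (hγm hA), smul_eq_mul]
    calc Measure.hausdorffMeasure 1 (A ∩ S)
        ≤ Measure.hausdorffMeasure 1 (γ '' (γ ⁻¹' A ∩ I)) := by
          refine measure_mono ?_
          rintro x ⟨hxA, hxS⟩
          obtain ⟨s, hs, rfl⟩ := hS hxS
          exact ⟨s, ⟨hxA, hs⟩, rfl⟩
      _ ≤ (K : ℝ≥0∞) ^ (1 : ℝ) * Measure.hausdorffMeasure 1 (γ ⁻¹' A ∩ I) :=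
          (hγ.mono inter_subset_right).hausdorffMeasure_image_le zero_le_one
      _ = _ := by rw [ENNReal.rpow_one, hausdorffMeasure_real]
  calc _ ≤ ∫⁻ x, f x ∂((K : ℝ≥0∞) • (volume.restrict I).map γ) := lintegral_mono' h le_rfl
    _ = _ := by rw [lintegral_smul_measure, lintegral_map hf hγm, smul_eq_mul]

/-- The trace inequality on a set of boundary points: `‖φ‖²_{L²(S ∩ ∂Ω)} ≤ C ‖φ‖²_{H¹(Ω)}` for the
functions `φ` of class `C^1` on the plane. -/
def HasTraceInequality (Ω S : Set Plane) : Prop :=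
  ∃ C : ℝ≥0, ∀ φ : Plane → ℝ, ContDiff ℝ 1 φ →
    ∫⁻ x in S, ‖φ x‖ₑ ^ 2 ∂(bdryMeasure Ω) ≤
      C * ((∫⁻ x in Ω, ‖φ x‖ₑ ^ 2) + ∫⁻ x in Ω, ‖fderiv ℝ φ x‖ₑ ^ 2)

theorem hasTraceInequality_of_subset_graph {Ω S : Set Plane} (e : Plane ≃ᵃⁱ[ℝ] Plane) {h : ℝ → ℝ}
    (hh : ContDiff ℝ 1 h) {a b η : ℝ} (hη : 0 < η) (hSm : MeasurableSet S)
    (hS : S ∩ frontier Ω ⊆ (fun s => graphChart e hh.continuous (s, 0)) '' Ioo a b)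
    (hΩ : graphChart e hh.continuous '' (Ioo a b ×ˢ Ioo 0 η) ⊆ Ω) :
    HasTraceInequality Ω S := by
  set Φ := graphChart e hh.continuous
  have hΦ : ContDiff ℝ 1 Φ := contDiff_graphChart e hh
  have hγ : ContDiff ℝ 1 fun s => Φ (s, 0) := hΦ.comp (contDiff_id.prodMk contDiff_const)
  obtain ⟨K, hK⟩ := (hγ.locallyLipschitz.locallyLipschitzOn
    (s := Icc a b)).exists_lipschitzOnWith_of_compact isCompact_Icc
  obtain ⟨C, hC⟩ := exists_trace_rect a b hη
  obtain ⟨D, hD⟩ := exists_lintegral_fderiv_comp_le e hh a b 0 η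
  refine ⟨K * C * (1 + D), fun φ hφ => ?_⟩
  have hm : Measurable fun x => ‖φ x‖ₑ ^ 2 := hφ.continuous.enorm.measurable.pow_const 2
  have h1 : ∫⁻ p in Ioo a b ×ˢ Ioo 0 η, ‖φ (Φ p)‖ₑ ^ 2 ≤ ∫⁻ x in Ω, ‖φ x‖ₑ ^ 2 := by
    rw [← setLIntegral_image_graphChart e hh.continuous (fun x => ‖φ x‖ₑ ^ 2)]
    exact lintegral_mono_set hΩ
  have h2 : ∫⁻ p in Ioo a b ×ˢ Ioo 0 η, ‖fderiv ℝ (φ ∘ Φ) p‖ₑ ^ 2 ≤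
      D * ∫⁻ x in Ω, ‖fderiv ℝ φ x‖ₑ ^ 2 := by
    refine (hD φ hφ).trans ?_
    gcongr
  calc ∫⁻ x in S, ‖φ x‖ₑ ^ 2 ∂(bdryMeasure Ω)
      = ∫⁻ x in S ∩ frontier Ω, ‖φ x‖ₑ ^ 2 ∂(Measure.hausdorffMeasure 1) := by
        rw [bdryMeasure, Measure.restrict_restrict hSm]
    _ ≤ K * ∫⁻ s in Ioo a b, ‖φ (Φ (s, 0))‖ₑ ^ 2 :=
        lintegral_hausdorffMeasure_le (hK.mono Ioo_subset_Icc_self) hγ.continuous.measurable hS hm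
    _ ≤ K * (C * ((∫⁻ p in Ioo a b ×ˢ Ioo 0 η, ‖φ (Φ p)‖ₑ ^ 2) +
          ∫⁻ p in Ioo a b ×ˢ Ioo 0 η, ‖fderiv ℝ (φ ∘ Φ) p‖ₑ ^ 2)) := by
        gcongr
        exact hC _ (hφ.comp hΦ)
    _ ≤ K * (C * ((1 + D) * (∫⁻ x in Ω, ‖φ x‖ₑ ^ 2) +
          (1 + D) * ∫⁻ x in Ω, ‖fderiv ℝ φ x‖ₑ ^ 2)) := by
        gcongr
        · exact h1.trans (le_mul_of_one_le_left' le_self_add)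
        · refine h2.trans ?_
          gcongr
          exact le_add_self
    _ = _ := by push_cast; ring

/-! ### Local inequalities on a smooth domain -/

theorem exists_Ioo_prod_Ioo_subset {V : Set (ℝ × ℝ)} (hV : IsOpen V) {p : ℝ × ℝ} (hp : p ∈ V) :
    ∃ δ > 0, Ioo (p.1 - δ) (p.1 + δ) ×ˢ Ioo (p.2 - δ) (p.2 + δ) ⊆ V := by
  obtain ⟨δ, hδ, h⟩ := Metric.isOpen_iff.1 hV p hp
  refine ⟨δ, hδ, ?_⟩
  rwa [← Real.ball_eq_Ioo, ← Real.ball_eq_Ioo, ball_prod_same]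

theorem hasTraceInequality_of_disjoint {Ω S : Set Plane} (hS : MeasurableSet S)
    (h : S ∩ frontier Ω = ∅) : HasTraceInequality Ω S := by
  refine ⟨0, fun φ _ => ?_⟩
  rw [bdryMeasure, Measure.restrict_restrict hS, h]
  simp

theorem exists_nhds_of_mem_isOpen {Ω : Set Plane} (hΩ : IsOpen Ω) {x : Plane} (hx : x ∈ Ω) :
    ∃ N : Set Plane, IsOpen N ∧ x ∈ N ∧ HasPoincareWirtinger (N ∩ Ω) ∧
      HasTraceInequality Ω N := by
  set Φ := graphChart (AffineIsometryEquiv.refl ℝ Plane)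
    (contDiff_const (𝕜 := ℝ) (E := ℝ) (c := (0 : ℝ)) (n := 1)).continuous
  obtain ⟨δ, hδ, h⟩ := exists_Ioo_prod_Ioo_subset (hΩ.preimage Φ.continuous)
    (p := Φ.symm x) (by simpa using hx)
  set Q := Ioo ((Φ.symm x).1 - δ) ((Φ.symm x).1 + δ) ×ˢ Ioo ((Φ.symm x).2 - δ) ((Φ.symm x).2 + δ)
  have hsub : Φ '' Q ⊆ Ω := image_subset_iff.2 h
  have hopen : IsOpen (Φ '' Q) := Φ.isOpen_image.2 (isOpen_Ioo.prod isOpen_Ioo)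
  refine ⟨Φ '' Q, hopen, ⟨Φ.symm x, ?_, by simp⟩, ?_, ?_⟩
  · simp only [Q, mem_prod, mem_Ioo]
    refine ⟨⟨?_, ?_⟩, ?_, ?_⟩ <;> linarith
  · rw [inter_eq_left.2 hsub]
    exact hasPoincareWirtinger_image_graphChart _ contDiff_const (by linarith) (by linarith)
  · refine hasTraceInequality_of_disjoint hopen.measurableSet ?_
    rw [← disjoint_iff_inter_eq_empty]
    exact (disjoint_frontier_iff_isOpen.2 hΩ).symm.mono_left hsub

/-- In a neighbourhood in which `Ω` is the strict epigraph of `h`, the boundary of `Ω` lies on the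
graph of `h`. -/
theorem eq_of_mem_frontier_of_epigraph {Ω U : Set Plane} (hΩ : IsOpen Ω) (hU : IsOpen U)
    {e : Plane ≃ᵃⁱ[ℝ] Plane} {h : ℝ → ℝ} (hh : Continuous h)
    (hgraph : ∀ y ∈ U, (y ∈ Ω ↔ h (e y 0) < e y 1)) {y : Plane} (hyU : y ∈ U)
    (hy : y ∈ frontier Ω) : e y 1 = h (e y 0) := by
  have hyΩ : y ∉ Ω := fun hy' => (disjoint_frontier_iff_isOpen.2 hΩ).le_bot ⟨hy, hy'⟩
  refine le_antisymm (not_lt.1 fun hlt => hyΩ ((hgraph y hyU).2 hlt)) (not_lt.1 fun hlt => ?_)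
  have h0 (i : Fin 2) : Continuous fun y => e y i :=
    (EuclideanSpace.proj i : Plane →L[ℝ] ℝ).continuous.comp e.continuous
  have hopen : IsOpen (U ∩ {z | e z 1 < h (e z 0)}) :=
    hU.inter (isOpen_lt (h0 1) (hh.comp (h0 0)))
  obtain ⟨z, ⟨hzU, hz⟩, hzΩ⟩ := mem_closure_iff.1 hy.1 _ hopen ⟨hyU, hlt⟩
  exact lt_asymm hz ((hgraph z hzU).1 hzΩ)

/-- Near a boundary point, a box in straightened coordinates meets `Ω` in its upper half and `∂Ω` in
its middle segment. -/
theorem exists_nhds_of_mem_frontier {Ω : Set Plane} (hΩ : IsOpen Ω) (hs : HasSmoothBoundary Ω)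
    {x : Plane} (hx : x ∈ frontier Ω) :
    ∃ N : Set Plane, IsOpen N ∧ x ∈ N ∧ HasPoincareWirtinger (N ∩ Ω) ∧
      HasTraceInequality Ω N := by
  obtain ⟨U, e, h, hU, hxU, hh, hgraph⟩ := hs x hx
  have hh1 : ContDiff ℝ 1 h := hh.of_le (by simp)
  set Φ := graphChart e hh1.continuous with hΦ
  have hsymm (y : Plane) : Φ.symm y = (e y 0, e y 1 - h (e y 0)) := rfl
  obtain ⟨δ, hδ, hsub⟩ := exists_Ioo_prod_Ioo_subset (hU.preimage Φ.continuous)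
    (p := Φ.symm x) (by simpa using hxU)
  have hx2 : (Φ.symm x).2 = 0 := by
    simp [hsymm, eq_of_mem_frontier_of_epigraph hΩ hU hh.continuous hgraph hxU hx]
  rw [hx2, zero_sub, zero_add] at hsub
  set a := (Φ.symm x).1 - δ
  set b := (Φ.symm x).1 + δ
  have hopen : IsOpen (Φ '' (Ioo a b ×ˢ Ioo (-δ) δ)) :=
    Φ.isOpen_image.2 (isOpen_Ioo.prod isOpen_Ioo)
  have hNU : Φ '' (Ioo a b ×ˢ Ioo (-δ) δ) ⊆ U := image_subset_iff.2 hsub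
  have hmem {y : Plane} (hy : y ∈ U) : y ∈ Ω ↔ 0 < (Φ.symm y).2 := by
    rw [hgraph y hy, hsymm, sub_pos]
  have hinter : Φ '' (Ioo a b ×ˢ Ioo (-δ) δ) ∩ Ω = Φ '' (Ioo a b ×ˢ Ioo 0 δ) := by
    ext y
    constructor
    · rintro ⟨hy, hyΩ⟩
      rw [hmem (hNU hy)] at hyΩ
      obtain ⟨p, ⟨hp1, hp2⟩, rfl⟩ := hy
      rw [Φ.symm_apply_apply] at hyΩ
      exact ⟨p, ⟨hp1, hyΩ, hp2.2⟩, rfl⟩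
    · rintro ⟨p, ⟨hp1, hp2⟩, rfl⟩
      have hy : Φ p ∈ Φ '' (Ioo a b ×ˢ Ioo (-δ) δ) :=
        ⟨p, ⟨hp1, by linarith [hp2.1], hp2.2⟩, rfl⟩
      refine ⟨hy, (hmem (hNU hy)).2 ?_⟩
      rw [Φ.symm_apply_apply]
      exact hp2.1
  refine ⟨_, hopen, ⟨Φ.symm x, ⟨⟨?_, ?_⟩, ?_, ?_⟩, by simp⟩, ?_, ?_⟩
  · simp only [a]; linarith
  · simp only [b]; linarith
  · rw [hx2]; linarith
  · rw [hx2]; exact hδ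
  · rw [hinter]
    exact hasPoincareWirtinger_image_graphChart e hh1 (by simp only [a, b]; linarith) hδ
  · refine hasTraceInequality_of_subset_graph e hh1 hδ hopen.measurableSet (a := a) (b := b) ?_
      (hinter ▸ inter_subset_right)
    rintro y ⟨hy, hyf⟩
    have hy2 : (Φ.symm y).2 = 0 := by
      simp [hsymm, eq_of_mem_frontier_of_epigraph hΩ hU hh.continuous hgraph (hNU hy) hyf]
    obtain ⟨p, ⟨hp1, hp2⟩, rfl⟩ := hy
    rw [Φ.symm_apply_apply] at hy2
    exact ⟨p.1, hp1, by rw [← hy2]⟩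

/-! ### From local to global -/

/-- Poincaré–Wirtinger inequalities on two open sets that meet give one on their union, since the
two constants are close in the `L²` norm of the intersection. -/
theorem HasPoincareWirtinger.union {A B : Set Plane} (hA : HasPoincareWirtinger A)
    (hB : HasPoincareWirtinger B) (hAo : IsOpen A) (hBo : IsOpen B) (hne : (A ∩ B).Nonempty)
    (hfin : volume B ≠ ⊤) : HasPoincareWirtinger (A ∪ B) := by
  obtain ⟨C, hC⟩ := hA
  obtain ⟨D, hD⟩ := hB
  have hpos : volume (A ∩ B) ≠ 0 := ((hAo.inter hBo).measure_pos volume hne).ne'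
  have hfin' : volume (A ∩ B) ≠ ⊤ := measure_ne_top_of_subset inter_subset_right hfin
  set k : ℝ≥0 := (volume B / volume (A ∩ B)).toNNReal with hk
  have hk' : (k : ℝ≥0∞) = volume B / volume (A ∩ B) :=
    ENNReal.coe_toNNReal (ENNReal.div_ne_top hfin hpos)
  refine ⟨C + 2 * D + 2 * (k * (2 * C + 2 * D)), fun φ hφ => ?_⟩
  obtain ⟨m, hm⟩ := hC φ hφ
  obtain ⟨n, hn⟩ := hD φ hφ
  refine ⟨m, ?_⟩
  set E := ∫⁻ x in A ∪ B, ‖fderiv ℝ φ x‖ₑ ^ 2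
  have hm' : ∫⁻ x in A, ‖φ x - m‖ₑ ^ 2 ≤ C * E := 
    hm.trans (mul_le_mul_right (lintegral_mono_set subset_union_left) _)
  have hn' : ∫⁻ x in B, ‖φ x - n‖ₑ ^ 2 ≤ D * E := 
    hn.trans (mul_le_mul_right (lintegral_mono_set subset_union_right) _)
  have hmeas (c : ℝ) : Measurable fun x => ‖φ x - c‖ₑ ^ 2 :=
    (hφ.continuous.sub continuous_const).enorm.measurable.pow_const 2
  have hmn : ‖n - m‖ₑ ^ 2 * volume (A ∩ B) ≤ (2 * C + 2 * D) * E := by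
    calc ‖n - m‖ₑ ^ 2 * volume (A ∩ B) = ∫⁻ _ in A ∩ B, ‖n - m‖ₑ ^ 2 := by
          rw [setLIntegral_const]
      _ ≤ ∫⁻ x in A ∩ B, (2 * ‖φ x - m‖ₑ ^ 2 + 2 * ‖φ x - n‖ₑ ^ 2) := by
          refine lintegral_mono fun x => ?_
          have := enorm_sub_sq_le n (φ x) m
          rwa [← enorm_neg (n - φ x), neg_sub, add_comm] at this
      _ = 2 * (∫⁻ x in A ∩ B, ‖φ x - m‖ₑ ^ 2) + 2 * ∫⁻ x in A ∩ B, ‖φ x - n‖ₑ ^ 2 := by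
          rw [lintegral_add_left ((hmeas m).const_mul 2), lintegral_const_mul _ (hmeas m),
            lintegral_const_mul _ (hmeas n)]
      _ ≤ 2 * (C * E) + 2 * (D * E) := by
          gcongr
          · exact (lintegral_mono_set inter_subset_left).trans hm'
          · exact (lintegral_mono_set inter_subset_right).trans hn'
      _ = _ := by ring
  have hmn' : volume B * ‖n - m‖ₑ ^ 2 ≤ k * ((2 * C + 2 * D) * E) := by
    calc volume B * ‖n - m‖ₑ ^ 2
        = volume B / volume (A ∩ B) * (‖n - m‖ₑ ^ 2 * volume (A ∩ B)) := by
          rw [mul_comm (‖n - m‖ₑ ^ 2), ← mul_assoc, ENNReal.div_mul_cancel hpos hfin']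
      _ ≤ _ := by rw [hk']; gcongr
  calc ∫⁻ x in A ∪ B, ‖φ x - m‖ₑ ^ 2
      ≤ (∫⁻ x in A, ‖φ x - m‖ₑ ^ 2) + ∫⁻ x in B, ‖φ x - m‖ₑ ^ 2 := lintegral_union_le _ _ _
    _ ≤ C * E + ∫⁻ x in B, (2 * ‖φ x - n‖ₑ ^ 2 + 2 * ‖n - m‖ₑ ^ 2) := by
        gcongr
        exact enorm_sub_sq_le _ _ _
    _ = C * E + (2 * (∫⁻ x in B, ‖φ x - n‖ₑ ^ 2) + 2 * (volume B * ‖n - m‖ₑ ^ 2)) := by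
        rw [lintegral_add_right _ measurable_const, lintegral_const_mul _ (hmeas n),
          setLIntegral_const]
        ring
    _ ≤ C * E + (2 * (D * E) + 2 * (k * ((2 * C + 2 * D) * E))) := by gcongr
    _ = _ := by push_cast; ring

/-- The Poincaré–Wirtinger inequality on a connected union of finitely many open sets: starting
from one of them, connectedness lets one adjoin the others one at a time, each meeting the union
of the previous ones. -/
theorem HasPoincareWirtinger.of_finset_cover {ι : Type*} {t : Finset ι} {A : ι → Set Plane}
    {Ω : Set Plane} (hconn : IsConnected Ω) (hfin : volume Ω ≠ ⊤) (hΩ : ⋃ i ∈ t, A i = Ω)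
    (hopen : ∀ i ∈ t, IsOpen (A i)) (hne : ∀ i ∈ t, (A i).Nonempty)
    (hA : ∀ i ∈ t, HasPoincareWirtinger (A i)) : HasPoincareWirtinger Ω := by
  classical
  have hsub {i : ι} (hi : i ∈ t) : A i ⊆ Ω := hΩ ▸ subset_biUnion_of_mem (u := A) hi
  have key (n : ℕ) : n + 1 ≤ t.card →
      ∃ S ⊆ t, S.card = n + 1 ∧ HasPoincareWirtinger (⋃ i ∈ S, A i) := by
    induction n with
    | zero =>
      intro h
      obtain ⟨i, hi⟩ := Finset.card_pos.1 h
      exact ⟨{i}, by simpa using hi, by simp, by simpa using hA i hi⟩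
    | succ n ih =>
      intro h
      obtain ⟨S, hSt, hScard, hS⟩ := ih (by omega)
      obtain ⟨i₀, hi₀⟩ : S.Nonempty := Finset.card_pos.1 (by omega)
      obtain ⟨j₀, hj₀⟩ : (t \ S).Nonempty := by
        rw [← Finset.card_pos, Finset.card_sdiff_of_subset hSt]
        omega
      have hSo : IsOpen (⋃ i ∈ S, A i) := isOpen_biUnion fun i hi => hopen i (hSt hi)
      have hTo : IsOpen (⋃ i ∈ t \ S, A i) :=
        isOpen_biUnion fun i hi => hopen i (Finset.mem_sdiff.1 hi).1
      have hcov : Ω ⊆ (⋃ i ∈ S, A i) ∪ ⋃ i ∈ t \ S, A i := by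
        rw [← Finset.set_biUnion_union, Finset.union_sdiff_of_subset hSt, hΩ]
      have hu : (Ω ∩ ⋃ i ∈ S, A i).Nonempty := by
        obtain ⟨x, hx⟩ := hne i₀ (hSt hi₀)
        exact ⟨x, hsub (hSt hi₀) hx, mem_biUnion hi₀ hx⟩
      have hv : (Ω ∩ ⋃ i ∈ t \ S, A i).Nonempty := by
        have hj := (Finset.mem_sdiff.1 hj₀).1
        obtain ⟨x, hx⟩ := hne j₀ hj
        exact ⟨x, hsub hj hx, mem_biUnion hj₀ hx⟩
      obtain ⟨x, -, hxS, hxT⟩ := hconn.isPreconnected _ _ hSo hTo hcov hu hv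
      obtain ⟨j, hj, hxj⟩ := mem_iUnion₂.1 hxT
      obtain ⟨hjt, hjS⟩ := Finset.mem_sdiff.1 hj
      refine ⟨insert j S, Finset.insert_subset hjt hSt, by
        rw [Finset.card_insert_of_notMem hjS, hScard], ?_⟩
      rw [Finset.set_biUnion_insert, union_comm]
      exact hS.union (hA j hjt) hSo (hopen j hjt) ⟨x, hxS, hxj⟩
        (measure_ne_top_of_subset (hsub hjt) hfin)
  obtain ⟨i, hi⟩ : t.Nonempty := by
    rw [Finset.nonempty_iff_ne_empty]
    rintro rfl
    exact hconn.nonempty.ne_empty (by simpa using hΩ.symm)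
  have hpos : 0 < t.card := Finset.card_pos.2 ⟨i, hi⟩
  obtain ⟨S, hSt, hScard, hS⟩ := key (t.card - 1) (by omega)
  rwa [Finset.eq_of_subset_of_card_le hSt (by omega), hΩ] at hS

section Domain

variable {Ω : Set Plane}

theorem exists_nhds_of_mem_closure (hΩ : IsOpen Ω) (hs : HasSmoothBoundary Ω) {x : Plane}
    (hx : x ∈ closure Ω) :
    ∃ N : Set Plane, IsOpen N ∧ x ∈ N ∧ HasPoincareWirtinger (N ∩ Ω) ∧
      HasTraceInequality Ω N := by
  rw [closure_eq_self_union_frontier] at hx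
  exact hx.elim (exists_nhds_of_mem_isOpen hΩ) (exists_nhds_of_mem_frontier hΩ hs)

theorem hasPoincareWirtinger_of_isConnected (hΩ : IsOpen Ω) (hconn : IsConnected Ω)
    (hbdd : Bornology.IsBounded Ω) (hs : HasSmoothBoundary Ω) : HasPoincareWirtinger Ω := by
  choose! N hNo hxN hN _ using fun x (hx : x ∈ closure Ω) => exists_nhds_of_mem_closure hΩ hs hx
  obtain ⟨t, ht, hcov⟩ := hbdd.isCompact_closure.elim_nhds_subcover N
    fun x hx => (hNo x hx).mem_nhds (hxN x hx)
  refine .of_finset_cover (t := t) (A := fun x => N x ∩ Ω) hconn hbdd.measure_lt_top.ne ?_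
    (fun x hx => (hNo x (ht x hx)).inter hΩ)
    (fun x hx => mem_closure_iff.1 (ht x hx) _ (hNo x (ht x hx)) (hxN x (ht x hx)))
    (fun x hx => hN x (ht x hx))
  rw [← iUnion₂_inter]
  exact inter_eq_right.2 (subset_closure.trans hcov)

theorem exists_trace_inequality (hΩ : IsOpen Ω) (hbdd : Bornology.IsBounded Ω)
    (hs : HasSmoothBoundary Ω) :
    ∃ C : ℝ≥0, ∀ φ : Plane → ℝ, ContDiff ℝ 1 φ →
      ∫⁻ x, ‖φ x‖ₑ ^ 2 ∂(bdryMeasure Ω) ≤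
        C * ((∫⁻ x in Ω, ‖φ x‖ₑ ^ 2) + ∫⁻ x in Ω, ‖fderiv ℝ φ x‖ₑ ^ 2) := by
  have h : HasTraceInequality Ω (closure Ω) := by
    refine hbdd.isCompact_closure.induction_on ⟨0, by simp⟩ ?_ ?_ ?_
    · rintro s t hst ⟨C, hC⟩
      exact ⟨C, fun φ hφ => (lintegral_mono_set hst).trans (hC φ hφ)⟩
    · rintro s t ⟨C, hC⟩ ⟨D, hD⟩
      refine ⟨C + D, fun φ hφ => (lintegral_union_le _ _ _).trans ?_⟩
      rw [ENNReal.coe_add, add_mul]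
      exact add_le_add (hC φ hφ) (hD φ hφ)
    · intro x hx
      obtain ⟨N, hNo, hxN, -, hN⟩ := exists_nhds_of_mem_closure hΩ hs hx
      exact ⟨N, mem_nhdsWithin_of_mem_nhds (hNo.mem_nhds hxN), hN⟩
  obtain ⟨C, hC⟩ := h
  refine ⟨C, fun φ hφ => ?_⟩
  have hr : (bdryMeasure Ω).restrict (closure Ω) = bdryMeasure Ω := by
    rw [bdryMeasure, Measure.restrict_restrict isClosed_closure.measurableSet,
      inter_eq_right.2 frontier_subset_closure]
  simpa only [hr] using hC φ hφ

/-- The length of `∂Ω` is finite: the trace inequality for the constant function `1`. -/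
theorem isFiniteMeasure_bdryMeasure (hΩ : IsOpen Ω) (hbdd : Bornology.IsBounded Ω)
    (hs : HasSmoothBoundary Ω) : IsFiniteMeasure (bdryMeasure Ω) := by
  obtain ⟨C, hC⟩ := exists_trace_inequality hΩ hbdd hs
  have h := hC (fun _ => 1) contDiff_const
  have h0 : ∫⁻ x in Ω, ‖fderiv ℝ (fun _ : Plane => (1 : ℝ)) x‖ₑ ^ 2 = 0 := by
    simp [enorm_eq_nnnorm]
  simp only [enorm_one, one_pow, lintegral_one, Measure.restrict_apply_univ, h0, add_zero] at h
  exact ⟨h.trans_lt (ENNReal.mul_lt_top (by simp) hbdd.measure_lt_top)⟩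

/-- The Friedrichs inequality for smooth functions, with a boundary term on a part `Γ₁` of `∂Ω` of
positive length. The constant `m` in the Poincaré–Wirtinger inequality is estimated on `Γ₁`, where
the trace inequality bounds `φ - m`. -/
theorem exists_friedrichs_inequality (hΩ : IsOpen Ω) (hconn : IsConnected Ω)
    (hbdd : Bornology.IsBounded Ω) (hs : HasSmoothBoundary Ω) {Γ₁ : Set Plane}
    (hpos : 0 < bdryMeasure Ω Γ₁) :
    ∃ C : ℝ≥0, ∀ φ : Plane → ℝ, ContDiff ℝ 1 φ →
      ∫⁻ x in Ω, ‖φ x‖ₑ ^ 2 ≤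
        C * ((∫⁻ x in Ω, ‖fderiv ℝ φ x‖ₑ ^ 2) + ∫⁻ x in Γ₁, ‖φ x‖ₑ ^ 2 ∂(bdryMeasure Ω)) := by
  obtain ⟨C, hC⟩ := hasPoincareWirtinger_of_isConnected hΩ hconn hbdd hs
  obtain ⟨D, hD⟩ := exists_trace_inequality hΩ hbdd hs
  have := isFiniteMeasure_bdryMeasure hΩ hbdd hs
  set σ := bdryMeasure Ω Γ₁ with hσ
  have hσtop : σ ≠ ⊤ := measure_ne_top _ _
  set k : ℝ≥0 := (volume Ω / σ).toNNReal with hk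
  have hk' : (k : ℝ≥0∞) = volume Ω / σ :=
    ENNReal.coe_toNNReal (ENNReal.div_ne_top hbdd.measure_lt_top.ne hpos.ne')
  refine ⟨2 * C + 2 * k * (2 * D * (C + 1)) + 2 * k * 2, fun φ hφ => ?_⟩
  obtain ⟨m, hm⟩ := hC φ hφ
  set E := ∫⁻ x in Ω, ‖fderiv ℝ φ x‖ₑ ^ 2
  set F := ∫⁻ x in Γ₁, ‖φ x‖ₑ ^ 2 ∂(bdryMeasure Ω)
  have hmeas : Measurable fun x => ‖φ x - m‖ₑ ^ 2 :=
    (hφ.continuous.sub continuous_const).enorm.measurable.pow_const 2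
  have hmeas' : Measurable fun x => ‖φ x‖ₑ ^ 2 := hφ.continuous.enorm.measurable.pow_const 2
  have hbd : ∫⁻ x in Γ₁, ‖φ x - m‖ₑ ^ 2 ∂(bdryMeasure Ω) ≤ D * ((C + 1) * E) := by
    refine (setLIntegral_le_lintegral _ _).trans
      ((hD (fun x => φ x - m) (hφ.sub contDiff_const)).trans ?_)
    simp only [fderiv_sub_const]
    rw [add_mul, one_mul]
    gcongr
  have hm1 : ‖m‖ₑ ^ 2 * σ ≤ 2 * (D * ((C + 1) * E)) + 2 * F := by
    calc ‖m‖ₑ ^ 2 * σ = ∫⁻ _ in Γ₁, ‖m‖ₑ ^ 2 ∂(bdryMeasure Ω) := by rw [setLIntegral_const]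
      _ ≤ ∫⁻ x in Γ₁, (2 * ‖φ x - m‖ₑ ^ 2 + 2 * ‖φ x‖ₑ ^ 2) ∂(bdryMeasure Ω) := by
          refine lintegral_mono fun x => ?_
          have := enorm_sub_sq_le m (φ x) 0
          rwa [← enorm_neg (m - φ x), neg_sub, sub_zero, sub_zero] at this
      _ = 2 * (∫⁻ x in Γ₁, ‖φ x - m‖ₑ ^ 2 ∂(bdryMeasure Ω)) + 2 * F := by
          rw [lintegral_add_left (hmeas.const_mul 2), lintegral_const_mul _ hmeas,
            lintegral_const_mul _ hmeas']
      _ ≤ _ := by gcongr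
  have hm2 : volume Ω * ‖m‖ₑ ^ 2 ≤ k * (2 * (D * ((C + 1) * E)) + 2 * F) := by
    calc volume Ω * ‖m‖ₑ ^ 2 = volume Ω / σ * (‖m‖ₑ ^ 2 * σ) := by
          rw [mul_comm (‖m‖ₑ ^ 2), ← mul_assoc, ENNReal.div_mul_cancel hpos.ne' hσtop]
      _ ≤ _ := by rw [hk']; gcongr
  calc ∫⁻ x in Ω, ‖φ x‖ₑ ^ 2 ≤ ∫⁻ x in Ω, (2 * ‖φ x - m‖ₑ ^ 2 + 2 * ‖m‖ₑ ^ 2) := by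
        refine lintegral_mono fun x => ?_
        simpa using enorm_sub_sq_le (φ x) m 0
    _ = 2 * (∫⁻ x in Ω, ‖φ x - m‖ₑ ^ 2) + 2 * (volume Ω * ‖m‖ₑ ^ 2) := by
        rw [lintegral_add_right _ measurable_const, lintegral_const_mul _ hmeas,
          setLIntegral_const]
        ring
    _ ≤ 2 * (C * E) + 2 * (k * (2 * (D * ((C + 1) * E)) + 2 * F)) := by gcongr
    _ = (2 * C + 2 * k * (2 * D * (C + 1))) * E + 2 * k * 2 * F := by ring
    _ ≤ (2 * C + 2 * k * (2 * D * (C + 1)) + 2 * k * 2) * E +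
        (2 * C + 2 * k * (2 * D * (C + 1)) + 2 * k * 2) * F := by
        exact add_le_add (mul_le_mul_left le_self_add _) (mul_le_mul_left le_add_self _)
    _ = _ := by push_cast; ring

end Domain

/-! ### Completeness of `H¹(Ω)` -/

theorem enorm_Lp_two_sq {α E : Type*} [MeasurableSpace α] [NormedAddCommGroup E] {μ : Measure α}
    (f : Lp E 2 μ) : ‖f‖ₑ ^ 2 = ∫⁻ x, ‖f x‖ₑ ^ 2 ∂μ := by
  have h := eLpNorm_nnreal_pow_eq_lintegral (μ := μ) (f := f) (p := 2) two_ne_zero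
  rw [Lp.enorm_def]
  simpa using h

section H1

variable {Ω : Set Plane}

theorem H1.norm_sq_eq (v : H1 Ω) : ‖v‖ ^ 2 = ‖H1.val v‖ ^ 2 + ‖H1.grad v‖ ^ 2 := by
  rw [H1.norm_def, WithLp.prod_norm_sq_eq_of_L2]
  rfl

theorem H1.norm_val_le (v : H1 Ω) : ‖H1.val v‖ ≤ ‖v‖ :=
  le_of_sq_le_sq (by rw [H1.norm_sq_eq]; nlinarith [sq_nonneg ‖H1.grad v‖]) (norm_nonneg _)

theorem H1.norm_grad_le (v : H1 Ω) : ‖H1.grad v‖ ≤ ‖v‖ :=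
  le_of_sq_le_sq (by rw [H1.norm_sq_eq]; nlinarith [sq_nonneg ‖H1.val v‖]) (norm_nonneg _)

theorem H1.continuous_val : Continuous (H1.val : H1 Ω →ₗ[ℝ] L2 Ω) :=
  AddMonoidHomClass.continuous_of_bound H1.val 1 fun v => by simpa using H1.norm_val_le v

theorem H1.continuous_grad : Continuous (H1.grad : H1 Ω →ₗ[ℝ] L2Vec Ω) :=
  AddMonoidHomClass.continuous_of_bound H1.grad 1 fun v => by simpa using H1.norm_grad_le v

theorem isClosed_subH1 : IsClosed (subH1 Ω : Set (WithLp 2 (L2 Ω × L2Vec Ω))) := by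
  have h : (subH1 Ω : Set (WithLp 2 (L2 Ω × L2Vec Ω))) =
      ⋂ (φ : Plane → ℝ) (_ : IsTestFunction Ω φ) (i : Fin 2),
        {p | ∫ x in Ω, p.fst x * partialDeriv i φ x = - ∫ x in Ω, p.snd x i * φ x} := by
    ext p
    simp only [mem_iInter]
    rfl
  rw [h]
  refine isClosed_iInter fun φ => isClosed_iInter fun hφ => isClosed_iInter fun i => ?_
  have h1 (u : L2 Ω) : ∫ x in Ω, u x * partialDeriv i φ x =
      inner ℝ ((hφ.memLp_partialDeriv i).toLp _) u := by
    rw [L2.inner_def]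
    refine integral_congr_ae ?_
    filter_upwards [(hφ.memLp_partialDeriv i).coeFn_toLp] with x hx
    simp [hx]
  have hm : MemLp (fun x => φ x • (EuclideanSpace.single i 1 : Plane)) 2 (volume.restrict Ω) :=
    hφ.memLp.continuousLinearMap_comp
      (ContinuousLinearMap.toSpanSingleton ℝ (EuclideanSpace.single i 1 : Plane))
  have h2 (G : L2Vec Ω) : ∫ x in Ω, G x i * φ x = inner ℝ (hm.toLp _) G := by
    rw [L2.inner_def]
    refine integral_congr_ae ?_
    filter_upwards [hm.coeFn_toLp] with x hx
    rw [hx, real_inner_smul_left, EuclideanSpace.inner_single_left]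
    simp [mul_comm]
  have c1 : Continuous fun p : WithLp 2 (L2 Ω × L2Vec Ω) => p.fst :=
    WithLp.prod_continuous_ofLp 2 _ _ |>.fst
  have c2 : Continuous fun p : WithLp 2 (L2 Ω × L2Vec Ω) => p.snd :=
    WithLp.prod_continuous_ofLp 2 _ _ |>.snd
  simp only [h1, h2]
  exact isClosed_eq (continuous_const.inner c1) (continuous_const.inner c2).neg

instance : CompleteSpace (H1 Ω) := isClosed_subH1.completeSpace_coe

end H1

/-! ### The trace operator -/

section Closure

variable {Ω : Set Plane}

theorem enorm_gradient (φ : Plane → ℝ) (x : Plane) : ‖gradient φ x‖ₑ = ‖fderiv ℝ φ x‖ₑ := by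
  simp only [enorm_eq_nnnorm, gradient, LinearIsometryEquiv.nnnorm_map]

theorem lintegral_eq_of_mem_smoothGraph {p : H1 Ω × L2Bdry Ω} (hp : p ∈ smoothGraph Ω) :
    ∃ φ : Plane → ℝ, ContDiff ℝ 1 φ ∧ ‖H1.val p.1‖ₑ ^ 2 = ∫⁻ x in Ω, ‖φ x‖ₑ ^ 2 ∧
      ‖H1.grad p.1‖ₑ ^ 2 = ∫⁻ x in Ω, ‖fderiv ℝ φ x‖ₑ ^ 2 ∧
      (p.2 : Plane → ℝ) =ᵐ[bdryMeasure Ω] φ := by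
  obtain ⟨φ, hφ, h1, h2, h3⟩ := hp
  refine ⟨φ, hφ.of_le (by simp), ?_, ?_, h3⟩
  · rw [enorm_Lp_two_sq]
    refine lintegral_congr_ae ?_
    filter_upwards [h1] with x hx
    rw [hx]
  · rw [enorm_Lp_two_sq]
    refine lintegral_congr_ae ?_
    filter_upwards [h2] with x hx
    rw [hx, enorm_gradient]

/-- The trace inequality on the closure of the graph of the restriction to `∂Ω`. -/
theorem exists_norm_snd_le_of_mem_closure (hΩ : IsOpen Ω) (hbdd : Bornology.IsBounded Ω)
    (hs : HasSmoothBoundary Ω) :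
    ∃ C : ℝ≥0, ∀ p ∈ (smoothGraph Ω).topologicalClosure, ‖p.2‖ ≤ C * ‖p.1‖ := by
  obtain ⟨C, hC⟩ := exists_trace_inequality hΩ hbdd hs
  have hsub : ((smoothGraph Ω).topologicalClosure : Set (H1 Ω × L2Bdry Ω)) ⊆
      {p | ‖p.2‖ ≤ NNReal.sqrt C * ‖p.1‖} := by
    refine closure_minimal (fun p hp => ?_) (isClosed_le (by fun_prop) (by fun_prop))
    obtain ⟨φ, hφ, h1, h2, h3⟩ := lintegral_eq_of_mem_smoothGraph hp
    have h := hC φ hφ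
    have h3' : ‖p.2‖ₑ ^ 2 = ∫⁻ x, ‖φ x‖ₑ ^ 2 ∂(bdryMeasure Ω) := by
      rw [enorm_Lp_two_sq]
      refine lintegral_congr_ae ?_
      filter_upwards [h3] with x hx
      rw [hx]
    rw [← h1, ← h2, ← h3'] at h
    simp only [enorm_eq_nnnorm] at h
    have h' : ‖p.2‖ ^ 2 ≤ C * (‖H1.val p.1‖ ^ 2 + ‖H1.grad p.1‖ ^ 2) := by exact_mod_cast h
    rw [← H1.norm_sq_eq] at h'
    refine le_of_sq_le_sq ?_ (mul_nonneg (NNReal.coe_nonneg _) (norm_nonneg _))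
    rwa [mul_pow, ← NNReal.coe_pow, NNReal.sq_sqrt]
  exact ⟨_, fun p hp => hsub hp⟩

/-- The Friedrichs inequality on the closure of the graph of the restriction to `∂Ω`. -/
theorem exists_norm_val_le_of_mem_closure (hΩ : IsOpen Ω) (hconn : IsConnected Ω)
    (hbdd : Bornology.IsBounded Ω) (hs : HasSmoothBoundary Ω) {Γ₁ : Set Plane}
    (hpos : 0 < bdryMeasure Ω Γ₁) :
    ∃ C : ℝ≥0, ∀ p ∈ (smoothGraph Ω).topologicalClosure, ‖H1.val p.1‖ ^ 2 ≤
      C * (‖H1.grad p.1‖ ^ 2 + ‖LpToLpRestrictCLM Plane ℝ ℝ (bdryMeasure Ω) 2 Γ₁ p.2‖ ^ 2) := by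
  obtain ⟨C, hC⟩ := exists_friedrichs_inequality hΩ hconn hbdd hs hpos
  have c1 : Continuous fun p : H1 Ω × L2Bdry Ω => H1.val p.1 :=
    H1.continuous_val.comp continuous_fst
  have c2 : Continuous fun p : H1 Ω × L2Bdry Ω => H1.grad p.1 :=
    H1.continuous_grad.comp continuous_fst
  have c3 : Continuous fun p : H1 Ω × L2Bdry Ω =>
      LpToLpRestrictCLM Plane ℝ ℝ (bdryMeasure Ω) 2 Γ₁ p.2 :=
    (ContinuousLinearMap.continuous _).comp continuous_snd
  have hsub : ((smoothGraph Ω).topologicalClosure : Set (H1 Ω × L2Bdry Ω)) ⊆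
      {p | ‖H1.val p.1‖ ^ 2 ≤ C * (‖H1.grad p.1‖ ^ 2 +
        ‖LpToLpRestrictCLM Plane ℝ ℝ (bdryMeasure Ω) 2 Γ₁ p.2‖ ^ 2)} := by
    refine closure_minimal (fun p hp => ?_)
      (isClosed_le (c1.norm.pow 2) (continuous_const.mul ((c2.norm.pow 2).add (c3.norm.pow 2))))
    obtain ⟨φ, hφ, h1, h2, h3⟩ := lintegral_eq_of_mem_smoothGraph hp
    have h := hC φ hφ
    have h3' : ‖LpToLpRestrictCLM Plane ℝ ℝ (bdryMeasure Ω) 2 Γ₁ p.2‖ₑ ^ 2 =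
        ∫⁻ x in Γ₁, ‖φ x‖ₑ ^ 2 ∂(bdryMeasure Ω) := by
      rw [enorm_Lp_two_sq]
      refine lintegral_congr_ae ?_
      filter_upwards [LpToLpRestrictCLM_coeFn ℝ Γ₁ p.2, ae_restrict_of_ae h3] with x hx hx'
      rw [hx, hx']
    rw [← h1, ← h2, ← h3'] at h
    simp only [enorm_eq_nnnorm] at h
    exact_mod_cast h
  exact ⟨C, fun p hp => hsub hp⟩

/-- By the trace inequality the closure of the graph of the restriction to `∂Ω` is single-valued,
so that `trace Ω` is not the junk value `0` of `Submodule.toLinearPMap`. -/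
theorem snd_eq_zero_of_mem_closure (hΩ : IsOpen Ω) (hbdd : Bornology.IsBounded Ω)
    (hs : HasSmoothBoundary Ω) (p : H1 Ω × L2Bdry Ω)
    (hp : p ∈ (smoothGraph Ω).topologicalClosure) (h0 : p.1 = 0) : p.2 = 0 := by
  obtain ⟨C, hC⟩ := exists_norm_snd_le_of_mem_closure hΩ hbdd hs
  simpa [h0] using hC p hp

theorem trace_mem_closure (hΩ : IsOpen Ω) (hbdd : Bornology.IsBounded Ω)
    (hs : HasSmoothBoundary Ω) (v : traceDomain Ω) :
    ((v : H1 Ω), trace Ω v) ∈ (smoothGraph Ω).topologicalClosure :=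
  Submodule.mem_graph_toLinearPMap (snd_eq_zero_of_mem_closure hΩ hbdd hs) v

theorem trace_eq_of_mem_closure (hΩ : IsOpen Ω) (hbdd : Bornology.IsBounded Ω)
    (hs : HasSmoothBoundary Ω) (v : traceDomain Ω) {w : L2Bdry Ω}
    (hw : ((v : H1 Ω), w) ∈ (smoothGraph Ω).topologicalClosure) : trace Ω v = w := by
  have h := snd_eq_zero_of_mem_closure hΩ hbdd hs _
    (Submodule.sub_mem _ (trace_mem_closure hΩ hbdd hs v) hw) (by simp)
  exact sub_eq_zero.1 h

theorem exists_norm_trace_le (hΩ : IsOpen Ω) (hbdd : Bornology.IsBounded Ω)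
    (hs : HasSmoothBoundary Ω) :
    ∃ C : ℝ≥0, ∀ v : traceDomain Ω, ‖trace Ω v‖ ≤ C * ‖(v : H1 Ω)‖ := by
  obtain ⟨C, hC⟩ := exists_norm_snd_le_of_mem_closure hΩ hbdd hs
  exact ⟨C, fun v => hC ((v : H1 Ω), trace Ω v) (trace_mem_closure hΩ hbdd hs v)⟩

end Closure

/-! ### The Hilbert space `X` -/

section SpaceX

variable {Ω Γ₁ : Set Plane}

theorem X.norm_def (v : X Ω Γ₁) : ‖v‖ = ‖H1.grad v.toH1‖ := rfl

theorem X.toH1_injective : Function.Injective (X.toH1 : X Ω Γ₁ →ₗ[ℝ] H1 Ω) :=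
  Subtype.val_injective.comp Subtype.val_injective

theorem X.restrict_trace_eq_zero (v : X Ω Γ₁) :
    LpToLpRestrictCLM Plane ℝ ℝ (bdryMeasure Ω) 2 Γ₁ v.trace = 0 := by
  rw [Lp.eq_zero_iff_ae_eq_zero]
  filter_upwards [LpToLpRestrictCLM_coeFn ℝ Γ₁ v.trace, v.2] with x hx hx'
  rw [hx]
  exact hx'

/-- The Friedrichs inequality: on `X` the norm of `H¹(Ω)` is bounded by the norm of the
gradient. -/
theorem X.exists_norm_toH1_le (hΩ : IsOpen Ω) (hconn : IsConnected Ω)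
    (hbdd : Bornology.IsBounded Ω) (hs : HasSmoothBoundary Ω) (hpos : 0 < bdryMeasure Ω Γ₁) :
    ∃ C : ℝ≥0, ∀ v : X Ω Γ₁, ‖v.toH1‖ ≤ C * ‖v‖ := by
  obtain ⟨C, hC⟩ := exists_norm_val_le_of_mem_closure hΩ hconn hbdd hs hpos
  refine ⟨NNReal.sqrt (C + 1), fun v => le_of_sq_le_sq ?_ (by positivity)⟩
  have h := hC _ (trace_mem_closure hΩ hbdd hs v.toDomain)
  have h0 := X.restrict_trace_eq_zero v
  rw [X.trace] at h0
  simp only [h0, norm_zero, ne_eq, OfNat.ofNat_ne_zero, not_false_eq_true, zero_pow,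
    add_zero] at h
  rw [mul_pow, ← NNReal.coe_pow, NNReal.sq_sqrt, H1.norm_sq_eq, X.norm_def]
  push_cast
  rw [add_mul, one_mul]
  exact add_le_add h le_rfl

theorem X.eq_zero_of_norm_eq_zero (hΩ : IsOpen Ω) (hconn : IsConnected Ω)
    (hbdd : Bornology.IsBounded Ω) (hs : HasSmoothBoundary Ω) (hpos : 0 < bdryMeasure Ω Γ₁)
    (v : X Ω Γ₁) (hv : ‖v‖ = 0) : v = 0 := by
  obtain ⟨C, hC⟩ := X.exists_norm_toH1_le hΩ hconn hbdd hs hpos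
  have h := hC v
  rw [hv, mul_zero, norm_le_zero_iff] at h
  exact X.toH1_injective (by rw [h, map_zero])

theorem X.exists_norm_trace_le (hΩ : IsOpen Ω) (hconn : IsConnected Ω)
    (hbdd : Bornology.IsBounded Ω) (hs : HasSmoothBoundary Ω) (hpos : 0 < bdryMeasure Ω Γ₁) :
    ∃ C : ℝ≥0, ∀ v : X Ω Γ₁, ‖v.trace‖ ≤ C * ‖v‖ := by
  obtain ⟨C, hC⟩ := X.exists_norm_toH1_le hΩ hconn hbdd hs hpos
  obtain ⟨D, hD⟩ := Antiplane.exists_norm_trace_le hΩ hbdd hs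
  refine ⟨D * C, fun v => (hD v.toDomain).trans ?_⟩
  rw [NNReal.coe_mul, mul_assoc]
  exact mul_le_mul_of_nonneg_left (hC v) D.2

theorem X.trace_add (u v : X Ω Γ₁) : (u + v).trace = u.trace + v.trace := by
  simp only [X.trace, map_add]

theorem X.trace_smul (c : ℝ) (v : X Ω Γ₁) : (c • v).trace = c • v.trace := by
  simp only [X.trace, map_smul]

theorem X.trace_sub (u v : X Ω Γ₁) : (u - v).trace = u.trace - v.trace := by
  simp only [X.trace, map_sub]

/-- `X` is complete: with the norm of `H¹(Ω)`, equivalent to the norm of `X` by the Friedrichs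
inequality, it is a closed part of the closure of the graph of the restriction to `∂Ω`. -/
theorem X.completeSpace (hΩ : IsOpen Ω) (hconn : IsConnected Ω)
    (hbdd : Bornology.IsBounded Ω) (hs : HasSmoothBoundary Ω) (hpos : 0 < bdryMeasure Ω Γ₁) :
    CompleteSpace (X Ω Γ₁) := by
  obtain ⟨C, hC⟩ := X.exists_norm_toH1_le hΩ hconn hbdd hs hpos
  obtain ⟨D, hD⟩ := X.exists_norm_trace_le hΩ hconn hbdd hs hpos
  have hL1 : LipschitzWith C (X.toH1 : X Ω Γ₁ →ₗ[ℝ] H1 Ω) :=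
    LipschitzWith.of_dist_le_mul fun u v => by
      simpa only [dist_eq_norm, map_sub] using hC (u - v)
  have hL2 : LipschitzWith D (X.trace : X Ω Γ₁ → L2Bdry Ω) :=
    LipschitzWith.of_dist_le_mul fun u v => by
      simpa only [dist_eq_norm, X.trace_sub] using hD (u - v)
  refine Metric.complete_of_cauchySeq_tendsto fun u hu => ?_
  obtain ⟨v, hv⟩ := cauchySeq_tendsto_of_complete (hL1.cauchySeq_comp hu)
  obtain ⟨w, hw⟩ := cauchySeq_tendsto_of_complete (hL2.cauchySeq_comp hu)
  have hmem : (v, w) ∈ (smoothGraph Ω).topologicalClosure :=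
    (smoothGraph Ω).isClosed_topologicalClosure.mem_of_tendsto (hv.prodMk_nhds hw)
      (.of_forall fun n => trace_mem_closure hΩ hbdd hs (u n).toDomain)
  have hvD : v ∈ traceDomain Ω := ⟨(v, w), hmem, rfl⟩
  have htr : Antiplane.trace Ω ⟨v, hvD⟩ = w := trace_eq_of_mem_closure hΩ hbdd hs ⟨v, hvD⟩ hmem
  have hw0 : LpToLpRestrictCLM Plane ℝ ℝ (bdryMeasure Ω) 2 Γ₁ w = 0 := by
    refine tendsto_nhds_unique
      (((LpToLpRestrictCLM Plane ℝ ℝ (bdryMeasure Ω) 2 Γ₁).continuous.tendsto w).comp hw) ?_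
    refine tendsto_const_nhds.congr fun n => ?_
    exact (X.restrict_trace_eq_zero (u n)).symm
  have hvX : (⟨v, hvD⟩ : traceDomain Ω) ∈ subX Ω Γ₁ := by
    change ∀ᵐ x ∂((bdryMeasure Ω).restrict Γ₁), Antiplane.trace Ω ⟨v, hvD⟩ x = 0
    rw [htr]
    rw [Lp.eq_zero_iff_ae_eq_zero] at hw0
    filter_upwards [LpToLpRestrictCLM_coeFn ℝ Γ₁ w, hw0] with x hx hx'
    rw [← hx, hx']
    rfl
  obtain ⟨x, hx⟩ : ∃ x : X Ω Γ₁, x.toH1 = v := ⟨⟨⟨v, hvD⟩, hvX⟩, rfl⟩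
  refine ⟨x, ?_⟩
  rw [tendsto_iff_norm_sub_tendsto_zero] at hv ⊢
  refine squeeze_zero (fun n => norm_nonneg _) (fun n => ?_) hv
  rw [X.norm_def, map_sub, hx]
  exact H1.norm_grad_le _

end SpaceX

/-! ### Multipliers for a seminorm on a Hilbert space -/

section Abstract

variable {E : Type*} [NormedAddCommGroup E] [InnerProductSpace ℝ E]

/-- Hahn–Banach: a continuous seminorm is attained at each point by a continuous functional below
it. -/
theorem exists_strongDual_le_seminorm_eq (p : Seminorm ℝ E) {C : ℝ} (hp : ∀ v, p v ≤ C * ‖v‖)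
    (u : E) : ∃ μ : StrongDual ℝ E, (∀ v, μ v ≤ p v) ∧ μ u = p u := by
  obtain rfl | hu := eq_or_ne u 0
  · exact ⟨0, fun v => by simp, by simp⟩
  set f : E →ₗ.[ℝ] ℝ := LinearPMap.mkSpanSingleton u (p u) hu
  have hfu : f.toFun ⟨u, Submodule.mem_span_singleton_self u⟩ = p u :=
    LinearPMap.mkSpanSingleton_apply ℝ ℝ hu (p u)
  obtain ⟨l, hl, hle⟩ := Module.Dual.exists_extension_of_le_seminorm_real f.domain f.toFun
    (p := p) (by
      rintro ⟨x, hx⟩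
      obtain ⟨c, rfl⟩ := Submodule.mem_span_singleton.1 hx
      have h : f.toFun ⟨c • u, hx⟩ = c * p u := by
        rw [← hfu, ← smul_eq_mul, ← map_smul]
        rfl
      rw [h, map_smul_eq_mul, Real.norm_eq_abs]
      exact mul_le_mul_of_nonneg_right (le_abs_self c) (apply_nonneg p u))
  have hcont (v : E) : ‖l v‖ ≤ C * ‖v‖ := (hle v).trans (hp v)
  refine ⟨l.mkContinuous C hcont, fun v => (le_abs_self _).trans (hle v), ?_⟩
  have h := hl ⟨u, Submodule.mem_span_singleton_self u⟩
  exact h.trans hfu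

/-- The multiplier is the projection of the load onto the closed convex set of functionals below
`p`; the variational inequality of the projection says that it attains `p` at `u`. -/
theorem exists_multiplier [CompleteSpace E] (p : Seminorm ℝ E) {C : ℝ}
    (hp : ∀ v, p v ≤ C * ‖v‖) {ξ : ℝ} (hξ : 0 < ξ) (F : StrongDual ℝ E) :
    ∃ (u : E) (l : StrongDual ℝ E), (∀ v, l v ≤ p v) ∧
      (∀ v, ξ * inner ℝ u v + l v = F v) ∧ l u = p u := by
  set K : Set E := {z | ∀ v, inner ℝ z v ≤ p v} with hK
  have hKconv : Convex ℝ K := by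
    intro x hx y hy s t hs ht hst v
    rw [inner_add_left, real_inner_smul_left, real_inner_smul_left]
    calc s * inner ℝ x v + t * inner ℝ y v ≤ s * p v + t * p v :=
          add_le_add (mul_le_mul_of_nonneg_left (hx v) hs) (mul_le_mul_of_nonneg_left (hy v) ht)
      _ = p v := by rw [← add_mul, hst, one_mul]
  have hKclosed : IsClosed K := by
    rw [hK, ofPred_forall]
    exact isClosed_iInter fun v => isClosed_le (continuous_id.inner continuous_const)
      continuous_const
  have hKne : K.Nonempty := ⟨0, fun v => by simp⟩
  set z := (InnerProductSpace.toDual ℝ E).symm F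
  have hz (v : E) : inner ℝ z v = F v := InnerProductSpace.toDual_symm_apply
  obtain ⟨k, hk, hmin⟩ := exists_norm_eq_iInf_of_complete_convex hKne hKclosed.isComplete hKconv z
  rw [norm_eq_iInf_iff_real_inner_le_zero hKconv hk] at hmin
  refine ⟨ξ⁻¹ • (z - k), InnerProductSpace.toDual ℝ E k, hk, fun v => ?_, ?_⟩
  · rw [real_inner_smul_left, mul_inv_cancel_left₀ hξ.ne', inner_sub_left, hz,
      InnerProductSpace.toDual_apply_apply]
    ring
  · -- A functional attaining `p` at `z - k`, compared with `k`, shows that `k` attains it as well.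
    obtain ⟨μ, hμ, hμz⟩ := exists_strongDual_le_seminorm_eq p hp (z - k)
    have h := hmin ((InnerProductSpace.toDual ℝ E).symm μ) fun v => by
      rw [InnerProductSpace.toDual_symm_apply]; exact hμ v
    rw [real_inner_comm, inner_sub_left, InnerProductSpace.toDual_symm_apply, hμz] at h
    have heq : inner ℝ k (z - k) = p (z - k) := le_antisymm (hk _) (by linarith)
    rw [InnerProductSpace.toDual_apply_apply, real_inner_smul_right, heq, map_smul_eq_mul,
      Real.norm_of_nonneg (inv_nonneg.2 hξ.le)]

end Abstract

/-- Uniqueness for `ξ (u, v) + l(v) = F(v)`: if the multipliers are monotone along the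
difference of two solutions, then the solutions agree. -/
theorem norm_sub_eq_zero_of_monotone {E : Type*} [SeminormedAddCommGroup E]
    [InnerProductSpace ℝ E] {ξ : ℝ} (hξ : 0 < ξ) {u₁ u₂ : E} {l₁ l₂ : E → ℝ}
    (h : ∀ v, ξ * inner ℝ u₁ v + l₁ v = ξ * inner ℝ u₂ v + l₂ v)
    (hmono : 0 ≤ l₁ (u₁ - u₂) - l₂ (u₁ - u₂)) : ‖u₁ - u₂‖ = 0 := by
  have h1 := h (u₁ - u₂)
  have h2 : ξ * ‖u₁ - u₂‖ ^ 2 ≤ 0 := by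
    rw [← real_inner_self_eq_norm_sq, inner_sub_left]
    linarith
  exact pow_eq_zero_iff two_ne_zero |>.1 (le_antisymm (nonpos_of_mul_nonpos_right h2 hξ)
    (sq_nonneg _))

/-! ### Friction and load functionals on `X` -/

section Functionals

variable {Ω Γ₁ : Set Plane}

theorem integrable_trace [IsFiniteMeasure (bdryMeasure Ω)] (v : X Ω Γ₁) :
    Integrable v.trace (bdryMeasure Ω) :=
  (Lp.memLp v.trace).integrable one_le_two

/-- The friction functional `j` as a seminorm on `X`. -/
noncomputable def jSeminorm [IsFiniteMeasure (bdryMeasure Ω)] (Γ₃ : Set Plane) {g : ℝ}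
    (hg : 0 ≤ g) : Seminorm ℝ (X Ω Γ₁) :=
  Seminorm.of (j Γ₃ g)
    (fun u v => by
      have hu := ((integrable_trace u).restrict (s := Γ₃)).abs.const_mul g
      have hv := ((integrable_trace v).restrict (s := Γ₃)).abs.const_mul g
      rw [j, j, j, ← integral_add hu hv]
      refine integral_mono_ae (((integrable_trace (u + v)).restrict (s := Γ₃)).abs.const_mul g)
        (hu.add hv) ?_
      rw [X.trace_add]
      filter_upwards [ae_restrict_of_ae (Lp.coeFn_add u.trace v.trace)] with x hx
      simp only [hx, Pi.add_apply, ← mul_add]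
      exact mul_le_mul_of_nonneg_left (abs_add_le _ _) hg)
    (fun c v => by
      rw [j, j, ← integral_const_mul]
      refine integral_congr_ae ?_
      rw [X.trace_smul]
      filter_upwards [ae_restrict_of_ae (Lp.coeFn_smul c v.trace)] with x hx
      simp only [hx, Pi.smul_apply, smul_eq_mul, abs_mul, Real.norm_eq_abs]
      ring)

theorem exists_j_le (hΩ : IsOpen Ω) (hconn : IsConnected Ω) (hbdd : Bornology.IsBounded Ω)
    (hs : HasSmoothBoundary Ω) (hpos : 0 < bdryMeasure Ω Γ₁) (Γ₃ : Set Plane) {g : ℝ}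
    (hg : 0 ≤ g) : ∃ C : ℝ, ∀ v : X Ω Γ₁, j Γ₃ g v ≤ C * ‖v‖ := by
  have := isFiniteMeasure_bdryMeasure hΩ hbdd hs
  obtain ⟨C, hC⟩ := X.exists_norm_trace_le hΩ hconn hbdd hs hpos
  set m := (bdryMeasure Ω univ ^ (1 / 2 : ℝ)).toReal
  refine ⟨g * (C * m), fun v => ?_⟩
  have h1 : ∫ x, |v.trace x| ∂(bdryMeasure Ω) ≤ ‖v.trace‖ * m := by
    have h := eLpNorm_le_eLpNorm_mul_rpow_measure_univ (p := 1) (q := 2) one_le_two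
      (Lp.aestronglyMeasurable v.trace)
    have he : (1 / (1 : ℝ≥0∞).toReal - 1 / (2 : ℝ≥0∞).toReal) = (1 / 2 : ℝ) := by norm_num
    rw [he] at h
    have htop : eLpNorm v.trace 2 (bdryMeasure Ω) * bdryMeasure Ω univ ^ (1 / 2 : ℝ) ≠ ⊤ :=
      ENNReal.mul_ne_top (Lp.eLpNorm_ne_top _)
        (ENNReal.rpow_ne_top_of_nonneg (by norm_num) (measure_ne_top _ _))
    have h' := ENNReal.toReal_mono htop h
    rw [ENNReal.toReal_mul, ← Lp.norm_def, eLpNorm_one_eq_lintegral_enorm,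
      ← integral_norm_eq_lintegral_enorm (Lp.aestronglyMeasurable v.trace)] at h'
    exact h'
  calc j Γ₃ g v = g * ∫ x in Γ₃, |v.trace x| ∂(bdryMeasure Ω) := integral_const_mul _ _
    _ ≤ g * (‖v.trace‖ * m) := by
        refine mul_le_mul_of_nonneg_left (le_trans ?_ h1) hg
        exact setIntegral_le_integral (integrable_trace v).abs (.of_forall fun x => abs_nonneg _)
    _ ≤ g * ((C * ‖v‖) * m) := by
        gcongr
        exact hC v
    _ = _ := by ring

/-- The load functional is continuous on `X`. -/
theorem exists_load_eq (hΩ : IsOpen Ω) (hconn : IsConnected Ω) (hbdd : Bornology.IsBounded Ω)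
    (hs : HasSmoothBoundary Ω) (hpos : 0 < bdryMeasure Ω Γ₁) {Γ₂ : Set Plane} (f₀ : L2 Ω)
    (f₂ : Lp ℝ 2 ((bdryMeasure Ω).restrict Γ₂)) :
    ∃ F : XDual Ω Γ₁, ∀ v, F v = load f₀ f₂ v := by
  obtain ⟨C, hC⟩ := X.exists_norm_toH1_le hΩ hconn hbdd hs hpos
  obtain ⟨D, hD⟩ := X.exists_norm_trace_le hΩ hconn hbdd hs hpos
  set R := LpToLpRestrictCLM Plane ℝ ℝ (bdryMeasure Ω) 2 Γ₂
  have hload (v : X Ω Γ₁) :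
      load f₀ f₂ v = inner ℝ f₀ (H1.val v.toH1) + inner ℝ f₂ (R v.trace) := by
    rw [load, L2.inner_def, L2.inner_def]
    congr 1
    · refine integral_congr_ae (.of_forall fun x => ?_)
      simp [mul_comm]
    · refine integral_congr_ae ?_
      filter_upwards [LpToLpRestrictCLM_coeFn ℝ Γ₂ v.trace] with x hx
      simp [R, hx, mul_comm]
  let F : X Ω Γ₁ →ₗ[ℝ] ℝ :=
    { toFun := load f₀ f₂
      map_add' := fun u v => by
        simp only [hload, map_add, X.trace_add, inner_add_right]
        ring
      map_smul' := fun c v => by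
        simp only [hload, map_smul, X.trace_smul, real_inner_smul_right, RingHom.id_apply,
          smul_eq_mul]
        ring }
  refine ⟨F.mkContinuous (‖f₀‖ * C + ‖f₂‖ * (‖R‖ * D)) fun v => ?_, fun v => rfl⟩
  change ‖load f₀ f₂ v‖ ≤ _
  rw [hload]
  calc _ ≤ ‖f₀‖ * ‖H1.val v.toH1‖ + ‖f₂‖ * ‖R v.trace‖ :=
        (norm_add_le _ _).trans (add_le_add (norm_inner_le_norm _ _) (norm_inner_le_norm _ _))
    _ ≤ ‖f₀‖ * (C * ‖v‖) + ‖f₂‖ * (‖R‖ * (D * ‖v‖)) := by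
        gcongr
        · exact (H1.norm_val_le _).trans (hC v)
        · exact (R.le_opNorm _).trans (mul_le_mul_of_nonneg_left (hD v) (norm_nonneg _))
    _ = _ := by ring

end Functionals

/-! ### Multipliers on `M` and on `X` -/

section Multipliers

variable {Ω Γ₁ : Set Plane}

theorem X.traceM_surjective : Function.Surjective (X.traceM : X Ω Γ₁ →ₗ[ℝ] M Ω Γ₁) :=
  LinearMap.surjective_rangeRestrict _

/-- A functional `l ∈ Λ̄` vanishes on the kernel of the trace, because `j` does, so it factors
through `γ : X → M`. The factor is continuous for the quotient norm: all preimages in `H¹(Ω)` of an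
element of `M` lie in `X`. -/
theorem exists_Y_of_mem_LamBar [IsFiniteMeasure (bdryMeasure Ω)] {Γ₃ : Set Plane} {g : ℝ}
    (hg : 0 ≤ g) {l : XDual Ω Γ₁} (hl : l ∈ LamBar Γ₃ g) :
    ∃ μ : Y Ω Γ₁, ∀ v, μ v.traceM = l v := by
  have hle (v : X Ω Γ₁) : |l v| ≤ j Γ₃ g v :=
    (jSeminorm Γ₃ hg).abs_le_of_le (f := l.toLinearMap) hl v
  have hker (v : X Ω Γ₁) (hv : v.traceM = 0) : l v = 0 := by
    have h0 : v.trace = 0 := congrArg (fun m : M Ω Γ₁ => H12.toL2 Ω m) hv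
    have hj : j Γ₃ g v = 0 := by
      rw [j, h0]
      refine integral_eq_zero_of_ae ?_
      filter_upwards [ae_restrict_of_ae (Lp.coeFn_zero ℝ 2 (bdryMeasure Ω))] with x hx
      simp only [hx, Pi.zero_apply, abs_zero, mul_zero]
    exact abs_nonpos_iff.1 ((hle v).trans hj.le)
  obtain ⟨s, hs⟩ := X.traceM.exists_rightInverse_of_surjective
    (LinearMap.range_eq_top.2 (X.traceM_surjective (Ω := Ω) (Γ₁ := Γ₁)))
  have hfac (v : X Ω Γ₁) : l (s v.traceM) = l v := by
    rw [← sub_eq_zero, ← map_sub]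
    refine hker _ ?_
    rw [map_sub, sub_eq_zero]
    exact LinearMap.congr_fun hs v.traceM
  refine ⟨(l.toLinearMap.comp s).mkContinuous ‖l‖ fun m => ?_, hfac⟩
  obtain ⟨v, rfl⟩ := X.traceM_surjective m
  change ‖l (s v.traceM)‖ ≤ _
  rw [hfac]
  refine le_of_forall_pos_le_add fun ε hε => ?_
  obtain ⟨w, hw, hlt⟩ := H12.exists_lt (v.traceM : H12 Ω)
    (div_pos hε (by positivity : (0 : ℝ) < ‖l‖ + 1))
  have htr : trace Ω w = v.trace := congrArg (H12.toL2 Ω) hw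
  obtain ⟨y, hy⟩ : ∃ y : X Ω Γ₁, y.toDomain = w := by
    refine ⟨⟨w, ?_⟩, rfl⟩
    change ∀ᵐ x ∂((bdryMeasure Ω).restrict Γ₁), trace Ω w x = 0
    rw [htr]
    exact v.2
  have hyv : l v = l y := by
    rw [← hfac v, ← hfac y]
    congr 2
    refine Subtype.ext ?_
    rw [← hw, ← hy]
    rfl
  have hny : ‖y‖ ≤ ‖w‖ := by
    rw [← hy]
    exact H1.norm_grad_le y.toH1
  calc ‖l v‖ ≤ ‖l‖ * ‖y‖ := by rw [hyv]; exact l.le_opNorm y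
    _ ≤ ‖l‖ * (‖v.traceM‖ + ε / (‖l‖ + 1)) := by
        refine mul_le_mul_of_nonneg_left (hny.trans hlt.le) (norm_nonneg l)
    _ = ‖l‖ * ‖v.traceM‖ + ‖l‖ / (‖l‖ + 1) * ε := by ring
    _ ≤ ‖l‖ * ‖v.traceM‖ + 1 * ε := by
        gcongr
        rw [div_le_one (by positivity)]
        linarith
    _ = _ := by rw [one_mul]

theorem Bt_eq_iff {μ : Y Ω Γ₁} {l : XDual Ω Γ₁} :
    Bt μ = l.toLinearMap ↔ ∀ v, μ v.traceM = l v :=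
  LinearMap.ext_iff

theorem eq_of_forall_traceM {μ ν : Y Ω Γ₁} (h : ∀ v : X Ω Γ₁, μ v.traceM = ν v.traceM) :
    μ = ν := by
  ext m
  obtain ⟨v, rfl⟩ := X.traceM_surjective m
  exact h v

end Multipliers

/-! ### Uniqueness in the three formulations -/

section Uniqueness

variable {Ω Γ₁ Γ₂ Γ₃ : Set Plane} {ξ g : ℝ} {f₀ : L2 Ω}
  {f₂ : Lp ℝ 2 ((bdryMeasure Ω).restrict Γ₂)}

theorem SolvesMixedDual.unique (hX : ∀ v : X Ω Γ₁, ‖v‖ = 0 → v = 0) (hξ : 0 < ξ)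
    {p q : X Ω Γ₁ × XDual Ω Γ₁} (hp : SolvesMixedDual Γ₃ ξ g f₀ f₂ p)
    (hq : SolvesMixedDual Γ₃ ξ g f₀ f₂ q) : p = q := by
  obtain ⟨hp1, hp2, hp3⟩ := hp
  obtain ⟨hq1, hq2, hq3⟩ := hq
  have heq (v : X Ω Γ₁) : ξ * inner ℝ p.1 v + p.2 v = ξ * inner ℝ q.1 v + q.2 v :=
    (hp2 v).trans (hq2 v).symm
  have h1 : p.1 = q.1 := by
    refine sub_eq_zero.1 (hX _ (norm_sub_eq_zero_of_monotone hξ heq ?_))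
    have h1 := hp3 _ hq1
    have h2 := hq3 _ hp1
    simp only [sub_apply] at h1 h2
    rw [map_sub, map_sub]
    linarith
  refine Prod.ext h1 (ContinuousLinearMap.ext fun v => ?_)
  have h := heq v
  rw [h1] at h
  linarith

theorem SolvesMixedTrace.unique (hX : ∀ v : X Ω Γ₁, ‖v‖ = 0 → v = 0) (hξ : 0 < ξ)
    {p q : X Ω Γ₁ × Y Ω Γ₁} (hp : SolvesMixedTrace Γ₃ ξ g f₀ f₂ p)
    (hq : SolvesMixedTrace Γ₃ ξ g f₀ f₂ q) : p = q := by
  obtain ⟨hp1, hp2, hp3⟩ := hp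
  obtain ⟨hq1, hq2, hq3⟩ := hq
  have heq (v : X Ω Γ₁) :
      ξ * inner ℝ p.1 v + p.2 v.traceM = ξ * inner ℝ q.1 v + q.2 v.traceM :=
    (hp2 v).trans (hq2 v).symm
  have h1 : p.1 = q.1 := by
    refine sub_eq_zero.1 (hX _ (norm_sub_eq_zero_of_monotone (l₁ := fun v => p.2 v.traceM)
      (l₂ := fun v => q.2 v.traceM) hξ heq ?_))
    have h1 := hp3 _ hq1
    have h2 := hq3 _ hp1
    simp only [sub_apply] at h1 h2
    simp only [map_sub]
    linarith
  refine Prod.ext h1 (eq_of_forall_traceM fun v => ?_)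
  have h := heq v
  rw [h1] at h
  linarith

theorem SolvesVI.unique (hX : ∀ v : X Ω Γ₁, ‖v‖ = 0 → v = 0) (hξ : 0 < ξ) {F : XDual Ω Γ₁}
    (hF : ∀ v, F v = load f₀ f₂ v) {u w : X Ω Γ₁}
    (hu : SolvesVI Γ₃ ξ g f₀ f₂ u) (hw : SolvesVI Γ₃ ξ g f₀ f₂ w) : u = w := by
  have h1 := hu w
  have h2 := hw u
  rw [← hF, a, map_sub, inner_sub_right] at h1 h2
  refine sub_eq_zero.1 (hX _ ?_)
  have h3 : ξ * ‖u - w‖ ^ 2 ≤ 0 := by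
    rw [← real_inner_self_eq_norm_sq, inner_sub_left, inner_sub_right, inner_sub_right]
    linarith
  exact pow_eq_zero_iff two_ne_zero |>.1 (le_antisymm (nonpos_of_mul_nonpos_right h3 hξ)
    (sq_nonneg _))

end Uniqueness

end Antiplane

open Antiplane
theorem theorem4p2
    {Ω Γ₁ Γ₂ Γ₃ : Set Plane}
    (hΩ_open : IsOpen Ω) (hΩ_conn : IsConnected Ω) (hΩ_bdd : Bornology.IsBounded Ω)
    (hΩ_smooth : HasSmoothBoundary Ω)
    (hΓ : Γ₁ ∪ Γ₂ ∪ Γ₃ = frontier Ω)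
    (h₁₂ : Disjoint Γ₁ Γ₂) (h₁₃ : Disjoint Γ₁ Γ₃) (h₂₃ : Disjoint Γ₂ Γ₃)
    (hm₁ : NullMeasurableSet Γ₁ (bdryMeasure Ω)) (hm₂ : NullMeasurableSet Γ₂ (bdryMeasure Ω))
    (hm₃ : NullMeasurableSet Γ₃ (bdryMeasure Ω))
    (hp₁ : 0 < bdryMeasure Ω Γ₁) (hp₂ : 0 < bdryMeasure Ω Γ₂) (hp₃ : 0 < bdryMeasure Ω Γ₃)
    (ξ g : ℝ) (hξ : 0 < ξ) (hg : 0 < g)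
    (f₀ : L2 Ω) (f₂ : Lp ℝ 2 ((bdryMeasure Ω).restrict Γ₂)) :
    (∃! u₀ : X Ω Γ₁, SolvesVI Γ₃ ξ g f₀ f₂ u₀) ∧
    (∃! p : X Ω Γ₁ × Y Ω Γ₁, SolvesMixedTrace Γ₃ ξ g f₀ f₂ p) ∧
    (∃! p : X Ω Γ₁ × XDual Ω Γ₁, SolvesMixedDual Γ₃ ξ g f₀ f₂ p) ∧
    ∀ (ubar : X Ω Γ₁) (lbar : XDual Ω Γ₁), SolvesMixedDual Γ₃ ξ g f₀ f₂ (ubar, lbar) →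
      (∃! ltilde : Y Ω Γ₁, Bt ltilde = lbar.toLinearMap) ∧
      (∀ ltilde : Y Ω Γ₁, Bt ltilde = lbar.toLinearMap →
        ∀ (u : X Ω Γ₁) (l : Y Ω Γ₁), SolvesMixedTrace Γ₃ ξ g f₀ f₂ (u, l) →
          ubar = u ∧ ltilde = l) ∧
      ∀ u₀ : X Ω Γ₁, SolvesVI Γ₃ ξ g f₀ f₂ u₀ → u₀ = ubar := by
  have := isFiniteMeasure_bdryMeasure hΩ_open hΩ_bdd hΩ_smooth
  have := X.completeSpace hΩ_open hΩ_conn hΩ_bdd hΩ_smooth hp₁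
  have hX := X.eq_zero_of_norm_eq_zero hΩ_open hΩ_conn hΩ_bdd hΩ_smooth hp₁
  obtain ⟨C, hC⟩ := exists_j_le hΩ_open hΩ_conn hΩ_bdd hΩ_smooth hp₁ Γ₃ hg.le
  obtain ⟨F, hF⟩ := exists_load_eq hΩ_open hΩ_conn hΩ_bdd hΩ_smooth hp₁ f₀ f₂
  obtain ⟨u, l, hl, heq, hlu⟩ : ∃ (u : X Ω Γ₁) (l : XDual Ω Γ₁), (∀ v, l v ≤ j Γ₃ g v) ∧
      (∀ v, ξ * inner ℝ u v + l v = F v) ∧ l u = j Γ₃ g u := by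
    -- The seminorm of `X` is a norm by the Friedrichs inequality.
    let : NormedAddCommGroup (X Ω Γ₁) := NormedAddCommGroup.ofSeparation hX
    exact exists_multiplier (jSeminorm Γ₃ hg.le) hC hξ F
  obtain ⟨m, hm⟩ := exists_Y_of_mem_LamBar hg.le hl
  have hdual : SolvesMixedDual Γ₃ ξ g f₀ f₂ (u, l) := by
    refine ⟨hl, fun v => (heq v).trans (hF v), fun μ hμ => ?_⟩
    have := hμ u
    simp only [sub_apply, hlu]
    linarith
  have htrace : SolvesMixedTrace Γ₃ ξ g f₀ f₂ (u, m) := by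
    refine ⟨fun v => (hm v).trans_le (hl v), fun v => ?_, fun μ hμ => ?_⟩
    · rw [hm]
      exact (heq v).trans (hF v)
    · have := hμ u
      simp only [sub_apply, hm, hlu]
      linarith
  have hvi : SolvesVI Γ₃ ξ g f₀ f₂ u := by
    intro v
    rw [← hF, ← heq, a, map_sub, hlu]
    linarith [hl v]
  refine ⟨⟨u, hvi, fun w hw => hw.unique hX hξ hF hvi⟩,
    ⟨(u, m), htrace, fun q hq => hq.unique hX hξ htrace⟩,
    ⟨(u, l), hdual, fun q hq => hq.unique hX hξ hdual⟩, fun ubar lbar hbar => ?_⟩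
  obtain ⟨rfl, rfl⟩ := Prod.ext_iff.1 (hbar.unique hX hξ hdual)
  refine ⟨⟨m, Bt_eq_iff.2 hm, fun μ hμ => eq_of_forall_traceM fun v => ?_⟩,
    fun μ hμ u' m' h' => ?_, fun w hw => hw.unique hX hξ hF hvi⟩
  · rw [Bt_eq_iff.1 hμ v, hm]
  · obtain ⟨rfl, rfl⟩ := Prod.ext_iff.1 (h'.unique hX hξ htrace)
    exact ⟨rfl, eq_of_forall_traceM fun v => by rw [Bt_eq_iff.1 hμ v, hm]⟩
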